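/- Let $E_4(\tau)=1+240\sum_{n\ge1}\frac{n^3q^n}{1-q^n}$, $q=e^{2\pi i\tau}$, and let $j=E_4^3/\Delta=q^{-1}+744+\cdots$ be the elliptic modular function on the upper half plane $\mathbb H$. Set $$x=2\,\frac{1/j(\tau_1)+1/j(\tau_2)-1728/(j(\tau_1)j(\tau_2))}{1+\sqrt{(1-1728/j(\tau_1))(1-1728/j(\tau_2))}},\qquad y=\frac1{j(\tau_1)j(\tau_2)x^2},\qquad F=(E_4(\tau_1)E_4(\tau_2))^{1/4},$$ where the roots denote any holomorphic branches on an open set $U\subset\mathbb H\times\mathbb H$ on which the expressions for $x$ and $y$ make sense (that is, $j(\tau_1)$, $j(\tau_2)$, the denominator of $x$, and $x$ itself do not vanish). Write $D_x=x\,\partial/\partial x$ and $D_y=y\,\partial/\partial y$. Then $F$, as a function of $x$ and $y$, satisfies $$(1-432x)D_x^2F-2D_xD_yF-432xD_xF-60xF=0,$$ $$(1-4y)D_y^2F+4yD_xD_yF-yD_x^2F+yD_xF-2yD_yF=0.$$ Precisely: near each point of $U$ with $j(\tau_1)\ne j(\tau_2)$ the pair $(x,y)$ is a system of local holomorphic coordinates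 (so there $F$ is locally a holomorphic function of $(x,y)$); and whenever $W\subset U$ and $V\subset\mathbb C^2$ are open, $(x,y)$ maps $W$ into $V$, and $\Phi$ is holomorphic on $V$ with $F=\Phi(x,y)$ on $W$, the function $\Phi$ satisfies both equations at every point $(x(\tau_1,\tau_2),y(\tau_1,\tau_2))$ with $(\tau_1,\tau_2)\in W$. -/

import Mathlib

noncomputable section

namespace TwoVarModular

/-- The normalised Eisenstein series `E₄ = 1 + 240 ∑ n³ qⁿ / (1 - qⁿ)` of weight `4`, as a function
of a complex variable `τ`; it is only ever evaluated at `0 < Im τ`. -/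
def e4 (τ : ℂ) : ℂ := ModularForm.E₄ (UpperHalfPlane.ofComplex τ)

/-- The elliptic modular function `j = E₄³ / Δ = q⁻¹ + 744 + ⋯`, as a function of a complex
variable `τ`; it is only ever evaluated at `0 < Im τ`. -/
def jInv (τ : ℂ) : ℂ :=
  e4 τ ^ 3 / ModularForm.discriminant (UpperHalfPlane.ofComplex τ)

/-- The function `x(τ₁, τ₂)` attached to a branch `S` of the square root of
`(1 - 1728 / j(τ₁)) (1 - 1728 / j(τ₂))`. -/
def xFun (S : ℂ × ℂ → ℂ) (p : ℂ × ℂ) : ℂ :=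
  2 * ((1 / jInv p.1 + 1 / jInv p.2 - 1728 / (jInv p.1 * jInv p.2)) / (1 + S p))

/-- The function `y(τ₁, τ₂) = 1 / (j(τ₁) j(τ₂) x²)`. -/
def yFun (S : ℂ × ℂ → ℂ) (p : ℂ × ℂ) : ℂ :=
  1 / (jInv p.1 * jInv p.2 * xFun S p ^ 2)

/-- The pair `(x, y)` as a map of `(τ₁, τ₂)`. -/
def xyMap (S : ℂ × ℂ → ℂ) (p : ℂ × ℂ) : ℂ × ℂ := (xFun S p, yFun S p)

/-- The operator `D_x = x ∂/∂x` on functions of `(x, y)`. -/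
def Dx (Φ : ℂ × ℂ → ℂ) (v : ℂ × ℂ) : ℂ := v.1 * deriv (fun s => Φ (s, v.2)) v.1

/-- The operator `D_y = y ∂/∂y` on functions of `(x, y)`. -/
def Dy (Φ : ℂ × ℂ → ℂ) (v : ℂ × ℂ) : ℂ := v.2 * deriv (fun s => Φ (v.1, s)) v.2

/-- The first equation of the system, at the point `v = (x, y)`. -/
def FirstEquation (Φ : ℂ × ℂ → ℂ) (v : ℂ × ℂ) : Prop :=
  (1 - 432 * v.1) * Dx (Dx Φ) v - 2 * Dx (Dy Φ) v - 432 * v.1 * Dx Φ v - 60 * v.1 * Φ v = 0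

/-- The second equation of the system, at the point `v = (x, y)`. -/
def SecondEquation (Φ : ℂ × ℂ → ℂ) (v : ℂ × ℂ) : Prop :=
  (1 - 4 * v.2) * Dy (Dy Φ) v + 4 * v.2 * Dx (Dy Φ) v - v.2 * Dx (Dx Φ) v
    + v.2 * Dx Φ v - 2 * v.2 * Dy Φ v = 0

end TwoVarModular

end

namespace TwoVarModular

/-! ### Ramanujan's differential equations for E₂, E₄, E₆ -/

section Ramanujan

open UpperHalfPlane hiding I
open Complex Filter Topology Derivative EisensteinSeries ModularForm Function
open scoped Real Manifold MatrixGroups ModularForm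

/-! Put t = 1/j and θ = t d/dt. Ramanujan's formulas (`normalizedDeriv_E₄`, `normalizedDeriv_E₆`,
`normalizedDeriv_E2`) give q d/dq log t = E₆/E₄ and show that g = E₄^(1/4) solves the hypergeometric
equation (1 - 1728t)θ²g = 864tθg + 60tg (`hasDerivAt_rootLog`). Hence F satisfies such an equation
in t₁ and another in t₂.

Since 1 - S² = 1728(t₁ + t₂ - 1728t₁t₂), x is just (1 - S)/864 (`xFun_eq`), and y = t₁t₂/x². The
chain rule turns the two ordinary equations into linear relations between Φ and its derivatives of
order at most two (`ordinary_equation_fst`). Where t₁ ≠ t₂ and neither E₆(τᵢ) vanishes, elimination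
yields the system (`system_of_ordinary`). Such points are dense in U, so continuity gives the rest
(`Represents.equations`).

For the coordinates, a vector killed by dx and dy is killed by dS and by d log(t₁t₂). The formula
for S² then forces it to vanish when t₁ ≠ t₂ (`eq_zero_of_jacobian_apply`); at zeros of E₆, where dt
= 0, the simple zero of S is used instead (`pderivFst_ne_zero`). -/

theorem tendsto_atImInfty_of_hasSum_qExpansion {f : ℍ → ℂ} {c : ℕ → ℂ}
    (hf : ∀ τ : ℍ, HasSum (fun m ↦ c m • Periodic.qParam 1 τ ^ m) (f τ)) :
    Tendsto f atImInfty (𝓝 (c 0)) := by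
  have hq0 : Tendsto (fun τ : ℍ ↦ Periodic.qParam 1 τ) atImInfty (𝓝 0) :=
    qParam_tendsto_atImInfty one_pos
  have hlim : Tendsto (fun τ : ℍ ↦ ∑' m, c m • Periodic.qParam 1 τ ^ m) atImInfty
      (𝓝 (∑' m, c m • (0 : ℂ) ^ m)) := by
    -- For Im τ ≥ 1 one has |q(τ)| ≤ |q(i)|, so the series at i is a summable majorant.
    refine tendsto_tsum_of_dominated_convergence
      (bound := fun m ↦ ‖c m • Periodic.qParam 1 UpperHalfPlane.I ^ m‖)
      (hf UpperHalfPlane.I).summable.norm (fun m ↦ (hq0.pow m).const_smul (c m)) ?_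
    filter_upwards [(atImInfty_basis.mem_of_mem (i := 1) trivial)] with τ hτ m
    rw [norm_smul, norm_smul, norm_pow, norm_pow]
    gcongr
    rw [Periodic.norm_qParam, Periodic.norm_qParam]
    have : (1 : ℝ) ≤ τ.im := hτ
    simp only [UpperHalfPlane.coe_im, UpperHalfPlane.I_im]
    gcongr Real.exp (?_ / 1)
    nlinarith [Real.pi_pos]
  have h0 : ∑' m, c m • (0 : ℂ) ^ m = c 0 := by
    rw [tsum_eq_single 0 (fun m hm ↦ by simp [hm])]
    simp
  rw [h0] at hlim
  exact hlim.congr fun τ ↦ (hf τ).tsum_eq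

theorem tendsto_E_atImInfty {k : ℕ} (hk : 3 ≤ k) (hk2 : Even k) :
    Tendsto (E hk : ℍ → ℂ) atImInfty (𝓝 1) := by
  have h := tendsto_atImInfty_of_hasSum_qExpansion (f := (E hk : ℍ → ℂ))
    (c := fun m ↦ (qExpansion 1 (E hk)).coeff m) fun τ ↦
      hasSum_qExpansion one_pos
        (SlashInvariantFormClass.periodic_comp_ofComplex _ one_mem_strictPeriods_SL)
        (ModularFormClass.holo (E hk)) (ModularFormClass.bdd_at_infty (E hk)) τ
  simpa only [E_qExpansion_coeff_zero hk hk2] using h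

theorem tendsto_E2_atImInfty : Tendsto E2 atImInfty (𝓝 1) := by
  have h := tendsto_atImInfty_of_hasSum_qExpansion (f := E2) fun τ ↦ by
    simpa only [Periodic.qParam, ofReal_one, div_one] using hasSum_qExpansion_E2 (z := τ)
  simpa using h

/-- Cauchy's estimate for f - c on the unit disc around z. -/
theorem tendsto_normalizedDeriv_atImInfty {f : ℍ → ℂ} (hf : MDiff f) {c : ℂ}
    (hc : Tendsto f atImInfty (𝓝 c)) : Tendsto (normalizedDerivOfComplex f) atImInfty (𝓝 0) := by
  suffices h : Tendsto (fun z : ℍ ↦ deriv (f ∘ ofComplex) z) atImInfty (𝓝 0) by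
    simpa only [mul_zero] using! h.const_mul ((2 * π * Complex.I)⁻¹)
  rw [UpperHalfPlane.mdifferentiable_iff] at hf
  rw [Metric.tendsto_nhds] at hc ⊢
  intro ε hε
  obtain ⟨A, -, hA⟩ := (atImInfty_basis.eventually_iff).mp (hc (ε / 2) (half_pos hε))
  -- The margin 2 keeps the closed unit disc around z inside the half plane and above height A.
  filter_upwards [atImInfty_basis.mem_of_mem (i := max A 0 + 2) trivial] with z hz
  have hz' : max A 0 + 2 ≤ z.im := hz
  have him : ∀ w ∈ Metric.closedBall (z : ℂ) 1, max A 0 + 1 ≤ w.im := by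
    intro w hw
    have h1 : |(w - z).im| ≤ 1 := (abs_im_le_norm _).trans (by simpa [dist_eq_norm] using hw)
    have h2 := (abs_le.mp h1).1
    simp only [sub_im, UpperHalfPlane.coe_im] at h2
    linarith
  have hpos : ∀ w ∈ Metric.closedBall (z : ℂ) 1, 0 < w.im := fun w hw ↦ by
    linarith [him w hw, le_max_right A 0]
  have hd : DifferentiableOn ℂ (fun w ↦ (f ∘ ofComplex) w - c) (Metric.closedBall (z : ℂ) 1) :=
    (hf.mono fun w hw ↦ hpos w hw).sub_const c
  have hb : ∀ w ∈ Metric.sphere (z : ℂ) 1, ‖(f ∘ ofComplex) w - c‖ ≤ ε / 2 := by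
    intro w hw
    have hw' := Metric.sphere_subset_closedBall hw
    have := hA (x := ofComplex w) (by
      change A ≤ (ofComplex w).im
      rw [ofComplex_apply_of_im_pos (hpos w hw')]
      change A ≤ w.im
      linarith [him w hw', le_max_left A 0])
    rw [dist_eq_norm] at this
    exact this.le
  have := norm_deriv_le_of_forall_mem_sphere_norm_le one_pos
    (hd.diffContOnCl_ball (subset_refl _)) hb
  rw [deriv_sub_const] at this
  rw [dist_zero_right]
  linarith

/-- A holomorphic function on the upper half plane that is invariant under the weight `k` action of
`SL(2, ℤ)` and has a limit at `i∞`, as a modular form. -/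
def modularFormOfTendsto {k : ℤ} (f : ℍ → ℂ) (hf : MDiff f) (hinv : ∀ γ : SL(2, ℤ), f ∣[k] γ = f)
    (c : ℂ) (hc : Tendsto f atImInfty (𝓝 c)) : ModularForm 𝒮ℒ k where
  toFun := f
  slash_action_eq' A hA := by
    obtain ⟨A, rfl⟩ := hA
    exact hinv A
  holo' := hf
  bdd_at_cusps' {c} hc' := by
    rw [Subgroup.IsArithmetic.isCusp_iff_isCusp_SL2Z] at hc'
    rw [OnePoint.isBoundedAt_iff_forall_SL2Z hc']
    intro γ _
    rw [hinv γ]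
    exact hc.isBigO_one ℝ

/-- In a one-dimensional space a form is determined by its constant term; each Ramanujan identity is
thereby reduced to a limit at i∞. -/
theorem eq_smul_of_rank_one {k : ℤ} (hr : Module.rank ℂ (ModularForm 𝒮ℒ k) = 1)
    (g : ModularForm 𝒮ℒ k) (hg : Tendsto g atImInfty (𝓝 1))
    (f : ℍ → ℂ) (hf : MDiff f) (hinv : ∀ γ : SL(2, ℤ), f ∣[k] γ = f)
    (c : ℂ) (hc : Tendsto f atImInfty (𝓝 c)) (z : ℍ) : f z = c * g z := by
  have hg0 : g ≠ 0 := by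
    rintro rfl
    have h0 : Tendsto (fun _ : ℍ ↦ (0 : ℂ)) atImInfty (𝓝 1) := hg
    exact zero_ne_one (tendsto_nhds_unique tendsto_const_nhds h0)
  obtain ⟨a, ha⟩ := (finrank_eq_one_iff_of_nonzero' g hg0).mp
    (Module.rank_eq_one_iff_finrank_eq_one.mp hr) (modularFormOfTendsto f hf hinv c hc)
  have hfa : ∀ z, f z = a * g z := fun z ↦ (congrFun (congrArg DFunLike.coe ha) z).symm
  have h1 : Tendsto f atImInfty (𝓝 (a * 1)) := (hg.const_mul a).congr fun z ↦ (hfa z).symm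
  rw [hfa, tendsto_nhds_unique hc h1, mul_one]

theorem tendsto_serreDerivative_atImInfty (k : ℂ) {f : ℍ → ℂ} (hf : MDiff f)
    (hc : Tendsto f atImInfty (𝓝 1)) :
    Tendsto (serreDerivative k f) atImInfty (𝓝 (-k / 12)) := by
  have h := (tendsto_normalizedDeriv_atImInfty hf hc).sub
    ((tendsto_E2_atImInfty.const_mul (k * 12⁻¹)).mul hc)
  refine Tendsto.congr (fun z ↦ rfl) (h.trans_eq ?_)
  congr 1
  ring

theorem slash_E {k : ℕ} (hk : 3 ≤ k) (γ : SL(2, ℤ)) :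
    (E hk : ℍ → ℂ) ∣[(k : ℤ)] γ = E hk :=
  (E hk).slash_action_eq' _ ⟨γ, rfl⟩

/-- The Serre derivative of E₄ has weight 6 and constant term -4/12, so it is -E₆/3. -/
theorem normalizedDeriv_E₄ (z : ℍ) :
    normalizedDerivOfComplex E₄ z = (E2 z * E₄ z - E₆ z) / 3 := by
  have h := eq_smul_of_rank_one (k := 6) levelOne_weight_six_rank_one E₆
    (tendsto_E_atImInfty _ ⟨3, rfl⟩) (serreDerivative 4 E₄)
    (serreDerivative_mdifferentiable 4 (ModularFormClass.holo E₄))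
    (fun γ ↦ serreDerivative_slash_invariant (k := 4) (ModularFormClass.holo E₄) (slash_E _ γ))
    _ (tendsto_serreDerivative_atImInfty 4 (ModularFormClass.holo E₄)
      (tendsto_E_atImInfty _ ⟨2, rfl⟩)) z
  rw [serreDerivative_apply] at h
  linear_combination h

/-- Weight 8 is spanned by E₄², and the constant term is now -6/12. -/
theorem normalizedDeriv_E₆ (z : ℍ) :
    normalizedDerivOfComplex E₆ z = (E2 z * E₆ z - E₄ z ^ 2) / 2 := by
  have hr : Module.rank ℂ (ModularForm 𝒮ℒ (4 + 4)) = 1 := by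
    have := dimension_level_one 8 ⟨4, rfl⟩
    simpa [Nat.ModEq] using this
  have hE := tendsto_E_atImInfty (k := 4) (by norm_num) ⟨2, rfl⟩
  have hlim : Tendsto (E₄.mul E₄) atImInfty (𝓝 1) := by
    simpa only [mul_one] using! hE.mul hE
  have h := eq_smul_of_rank_one (k := 4 + 4) hr (E₄.mul E₄)
    hlim (serreDerivative 6 E₆)
    (serreDerivative_mdifferentiable 6 (ModularFormClass.holo E₆))
    (fun γ ↦ serreDerivative_slash_invariant (k := 6) (ModularFormClass.holo E₆) (slash_E _ γ))
    _ (tendsto_serreDerivative_atImInfty 6 (ModularFormClass.holo E₆)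
      (tendsto_E_atImInfty _ ⟨3, rfl⟩)) z
  rw [serreDerivative_apply] at h
  have hm : (E₄.mul E₄) z = E₄ z * E₄ z := rfl
  rw [hm] at h
  linear_combination h

theorem normalizedDeriv_div_denom (γ : SL(2, ℤ)) (z : ℍ) :
    MDiff (fun z : ℍ ↦ (γ 1 0 : ℂ) / denom γ z) ∧
    normalizedDerivOfComplex (fun z : ℍ ↦ (γ 1 0 : ℂ) / denom γ z) z =
      -(2 * π * Complex.I)⁻¹ * ((γ 1 0 : ℂ) / denom γ z) ^ 2 := by
  have hd : ∀ z : ℍ, HasDerivAt ((fun z : ℍ ↦ (γ 1 0 : ℂ) / denom γ z) ∘ ofComplex)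
      (-((γ 1 0 : ℂ) / denom γ z) ^ 2) z := by
    intro z
    have hz := denom_ne_zero γ z
    have h1 : HasDerivAt (fun w : ℂ ↦ (γ 1 0 : ℂ) * w + γ 1 1) (γ 1 0 : ℂ) z := by
      simpa using ((hasDerivAt_id (z : ℂ)).const_mul (γ 1 0 : ℂ)).add_const (γ 1 1 : ℂ)
    have hz' : (γ 1 0 : ℂ) * z + γ 1 1 ≠ 0 := by simpa [ModularGroup.denom_apply] using hz
    have h2 := (h1.inv hz').const_mul (γ 1 0 : ℂ)
    have h3 : HasDerivAt (fun w : ℂ ↦ (γ 1 0 : ℂ) * ((γ 1 0 : ℂ) * w + γ 1 1)⁻¹)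
      (-((γ 1 0 : ℂ) / denom γ z) ^ 2) z := by
      convert! h2 using 1
      rw [ModularGroup.denom_apply, div_pow]
      ring
    refine h3.congr_of_eventuallyEq ?_
    filter_upwards [isOpen_upperHalfPlaneSet.mem_nhds z.im_pos] with w hw
    simp only [comp_apply, ModularGroup.denom_apply, ofComplex_apply_of_im_pos hw]
    rfl
  refine ⟨fun z ↦ mdifferentiableAt_iff.mpr (hd z).differentiableAt, ?_⟩
  rw [normalizedDerivOfComplex, (hd z).deriv]
  ring

/-- With r = c/(cz + d), E₂ transforms to E₂ - (6i/π)r, and Dr = -r²/(2πi). The resulting anomalies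
of DE₂ and of E₂²/12 cancel. -/
theorem slash_normalizedDeriv_E2_sub (γ : SL(2, ℤ)) :
    (fun z ↦ normalizedDerivOfComplex E2 z - E2 z ^ 2 / 12) ∣[(4 : ℤ)] γ =
      fun z ↦ normalizedDerivOfComplex E2 z - E2 z ^ 2 / 12 := by
  ext z
  set r : ℍ → ℂ := fun z ↦ (γ 1 0 : ℂ) / denom γ z with hr
  have hκ : (1 / (2 * riemannZeta 2)) • D2 γ = (6 * Complex.I / π) • r := by
    ext w
    simp only [riemannZeta_two, D2, Pi.smul_apply, smul_eq_mul, hr]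
    have : (π : ℂ) ≠ 0 := by exact_mod_cast Real.pi_ne_zero
    field_simp
  have hE : E2 ∣[(2 : ℤ)] γ = E2 - (6 * Complex.I / π) • r := by rw [E2_slash_action, hκ]
  have hrd := normalizedDeriv_div_denom γ z
  have h1 := congrFun (normalizedDerivOfComplex_SL_slash (k := 2) E2_mdifferentiable (γ := γ)) z
  rw [hE, normalizedDerivOfComplex_sub _ _ E2_mdifferentiable (hrd.1.const_smul _),
    normalizedDerivOfComplex_smul _ _ hrd.1] at h1
  simp only [Pi.sub_apply, Pi.smul_apply, smul_eq_mul, hrd.2] at h1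
  have h2 := congrFun hE z
  have h3 := congrFun (mul_slash_SL2 2 2 γ E2 E2) z
  rw [Pi.mul_apply, h2] at h3
  simp only [Pi.sub_apply, Pi.smul_apply, smul_eq_mul] at h3
  have hsplit : ((fun z ↦ normalizedDerivOfComplex E2 z - E2 z ^ 2 / 12) ∣[(4 : ℤ)] γ) z =
      (normalizedDerivOfComplex E2 ∣[(2 + 2 : ℤ)] γ) z - ((E2 * E2) ∣[(2 + 2 : ℤ)] γ) z / 12 := by
    simp only [SL_slash_apply, Pi.mul_apply]
    norm_num
    ring
  rw [hsplit, h3]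
  have hπ : (π : ℂ) ≠ 0 := by exact_mod_cast Real.pi_ne_zero
  have hinv : (2 * π * Complex.I)⁻¹ = -Complex.I / (2 * π) := by
    rw [mul_inv, Complex.inv_I]
    ring
  rw [hinv] at h1
  have hrz : (γ 1 0 : ℂ) / denom γ z = r z := rfl
  rw [hrz] at h1
  have h1' : (normalizedDerivOfComplex E2 ∣[(2 + 2 : ℤ)] γ) z = normalizedDerivOfComplex E2 z -
      6 * Complex.I / π * (-(-Complex.I / (2 * π)) * r z ^ 2) +
      ((2 : ℤ) : ℂ) * (-Complex.I / (2 * π)) * r z * (E2 z - 6 * Complex.I / π * r z) := by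
    linear_combination -h1
  rw [h1']
  push_cast
  field_simp
  ring_nf

theorem normalizedDeriv_E2 (z : ℍ) :
    normalizedDerivOfComplex E2 z = (E2 z ^ 2 - E₄ z) / 12 := by
  have hlim : Tendsto (fun z ↦ normalizedDerivOfComplex E2 z - E2 z ^ 2 / 12) atImInfty
      (𝓝 (0 - 1 ^ 2 / 12)) :=
    (tendsto_normalizedDeriv_atImInfty E2_mdifferentiable tendsto_E2_atImInfty).sub
      ((tendsto_E2_atImInfty.pow 2).div_const 12)
  let g : ℍ → ℂ := fun z ↦ normalizedDerivOfComplex E2 z - E2 z ^ 2 / 12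
  have hd : MDiff g := by
    have h1 := UpperHalfPlane.mdifferentiable_iff.mp
      (normalizedDerivOfComplex_mdifferentiable E2_mdifferentiable)
    have h2 := UpperHalfPlane.mdifferentiable_iff.mp E2_mdifferentiable
    exact UpperHalfPlane.mdifferentiable_iff.mpr ((h1.sub ((h2.pow 2).div_const 12)).congr
      fun _ _ ↦ rfl)
  have h := eq_smul_of_rank_one (k := 4) levelOne_weight_four_rank_one E₄
    (tendsto_E_atImInfty _ ⟨2, rfl⟩) g hd slash_normalizedDeriv_E2_sub _ hlim z
  linear_combination h

end Ramanujan

/-! ### Partial derivatives of holomorphic functions of two variables -/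

section Partial

open Filter Topology Set

/-- The partial derivative in the first variable. -/
noncomputable def pderivFst (Φ : ℂ × ℂ → ℂ) (v : ℂ × ℂ) : ℂ := deriv (fun s ↦ Φ (s, v.2)) v.1

/-- The partial derivative in the second variable. -/
noncomputable def pderivSnd (Φ : ℂ × ℂ → ℂ) (v : ℂ × ℂ) : ℂ := deriv (fun s ↦ Φ (v.1, s)) v.2

variable {V : Set (ℂ × ℂ)} {Φ : ℂ × ℂ → ℂ}

theorem exists_ball_prod_subset (hV : IsOpen V) {v : ℂ × ℂ} (hv : v ∈ V) :
    ∃ r > 0, ∀ s ∈ Metric.ball v.1 r, ∀ t ∈ Metric.ball v.2 r, (s, t) ∈ V := by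
  obtain ⟨r, hr, h⟩ := Metric.isOpen_iff.mp hV v hv
  refine ⟨r, hr, fun s hs t ht ↦ h ?_⟩
  rw [Metric.mem_ball] at *
  exact max_lt hs ht

/-- Weierstrass: by joint continuity the slices Φ(·, y) tend to Φ(·, b) locally uniformly as y → b,
hence so do their derivatives. -/
theorem continuousOn_pderivFst (hV : IsOpen V) (hc : ContinuousOn Φ V)
    (hd : ∀ v ∈ V, DifferentiableAt ℂ (fun s ↦ Φ (s, v.2)) v.1) :
    ContinuousOn (pderivFst Φ) V := by
  rintro ⟨a, b⟩ hab
  refine ContinuousAt.continuousWithinAt ?_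
  obtain ⟨r, hr, hball⟩ := exists_ball_prod_subset hV hab
  have hlim : TendstoLocallyUniformlyOn (fun y s ↦ Φ (s, y)) (fun s ↦ Φ (s, b)) (𝓝 b)
      (Metric.ball a r) := by
    rw [Metric.tendstoLocallyUniformlyOn_iff]
    intro ε hε x hx
    have hxb := hball x hx b (Metric.mem_ball_self hr)
    have hcont := (hc.continuousAt (hV.mem_nhds hxb)).tendsto
    obtain ⟨δ, hδ, h⟩ := Metric.eventually_nhds_iff_ball.mp
      (Metric.tendsto_nhds.mp hcont (ε / 2) (half_pos hε))
    refine ⟨Metric.ball x δ, mem_nhdsWithin_of_mem_nhds (Metric.ball_mem_nhds x hδ), ?_⟩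
    filter_upwards [Metric.ball_mem_nhds b hδ] with y hy s hs
    have h1 := h (s, b) (by simpa [← ball_prod_same] using ⟨hs, hδ⟩)
    have h2 := h (s, y) (by simpa [← ball_prod_same] using ⟨hs, hy⟩)
    rw [dist_comm] at h2
    calc dist (Φ (s, b)) (Φ (s, y)) ≤ _ := dist_triangle _ _ _
      _ < ε := by linarith
  have hF : ∀ y ∈ Metric.ball b r, DifferentiableOn ℂ (fun s ↦ Φ (s, y)) (Metric.ball a r) :=
    fun y hy s hs ↦ (hd (s, y) (hball s hs y hy)).differentiableWithinAt
  have hderiv := hlim.deriv (eventually_of_mem (Metric.ball_mem_nhds b hr) hF) Metric.isOpen_ball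
  have hca : ContinuousAt (deriv fun s ↦ Φ (s, b)) a :=
    ((hF b (Metric.mem_ball_self hr)).deriv Metric.isOpen_ball).continuousOn.continuousAt
      (Metric.ball_mem_nhds a hr)
  rw [Metric.tendstoLocallyUniformlyOn_iff] at hderiv
  rw [ContinuousAt, Metric.tendsto_nhds]
  intro ε hε
  obtain ⟨t, ht, h⟩ := hderiv (ε / 2) (half_pos hε) a (Metric.mem_ball_self hr)
  rw [Metric.isOpen_ball.nhdsWithin_eq (Metric.mem_ball_self hr)] at ht
  have h3 := Metric.tendsto_nhds.mp hca.tendsto (ε / 2) (half_pos hε)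
  rw [nhds_prod_eq]
  filter_upwards [prod_mem_prod (inter_mem ht h3) h] with ⟨s, y⟩ ⟨⟨hs, hs'⟩, hy⟩
  have h4 := hy s hs
  rw [dist_comm] at h4
  calc dist (pderivFst Φ (s, y)) (pderivFst Φ (a, b)) ≤ _ := dist_triangle _ _ _
    _ < ε / 2 + ε / 2 := add_lt_add h4 hs'
    _ = ε := add_halves ε

theorem differentiable_swap : Differentiable ℂ (Prod.swap : ℂ × ℂ → ℂ × ℂ) :=
  differentiable_snd.prodMk differentiable_fst

theorem isOpen_swap (hV : IsOpen V) : IsOpen (Prod.swap ⁻¹' V) := hV.preimage continuous_swap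

theorem continuousOn_pderivSnd (hV : IsOpen V) (hc : ContinuousOn Φ V)
    (hd : ∀ v ∈ V, DifferentiableAt ℂ (fun s ↦ Φ (v.1, s)) v.2) :
    ContinuousOn (pderivSnd Φ) V := by
  have h := continuousOn_pderivFst (Φ := Φ ∘ Prod.swap) (isOpen_swap hV)
    (hc.comp continuous_swap.continuousOn fun _ h ↦ h) (fun v hv ↦ hd v.swap hv)
  exact h.comp (t := Prod.swap ⁻¹' V) continuous_swap.continuousOn fun v hv ↦ by simpa using hv

theorem differentiableAt_fst (hV : IsOpen V) (hd : DifferentiableOn ℂ Φ V) {v : ℂ × ℂ}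
    (hv : v ∈ V) : DifferentiableAt ℂ (fun s ↦ Φ (s, v.2)) v.1 :=
  DifferentiableAt.comp v.1 (f := fun s ↦ (s, v.2)) (hd.differentiableAt (hV.mem_nhds hv))
    (by fun_prop)

theorem differentiableAt_snd (hV : IsOpen V) (hd : DifferentiableOn ℂ Φ V) {v : ℂ × ℂ}
    (hv : v ∈ V) : DifferentiableAt ℂ (fun s ↦ Φ (v.1, s)) v.2 :=
  DifferentiableAt.comp v.2 (f := fun s ↦ (v.1, s)) (hd.differentiableAt (hV.mem_nhds hv))
    (by fun_prop)

/-- The difference quotients of Φ in the second variable converge locally uniformly in the first, so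
by Weierstrass the limit may be differentiated in the first variable. Symmetry of the mixed
derivatives comes with it. -/
theorem hasDerivAt_pderivFst_snd (hV : IsOpen V) (hd : DifferentiableOn ℂ Φ V) {v : ℂ × ℂ}
    (hv : v ∈ V) :
    HasDerivAt (fun y ↦ pderivFst Φ (v.1, y)) (pderivFst (pderivSnd Φ) v) v.2 := by
  obtain ⟨a, b⟩ := v
  obtain ⟨r, hr, hball⟩ := exists_ball_prod_subset hV hv
  have hc2 := continuousOn_pderivSnd hV hd.continuousOn fun v ↦ differentiableAt_snd hV hd
  have hlim : TendstoLocallyUniformlyOn (fun y s ↦ slope (fun t ↦ Φ (s, t)) b y)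
      (fun s ↦ pderivSnd Φ (s, b)) (𝓝[≠] b) (Metric.ball a r) := by
    rw [Metric.tendstoLocallyUniformlyOn_iff]
    intro ε hε x hx
    have hxb := hball x hx b (Metric.mem_ball_self hr)
    have hcont := (hc2.continuousAt (hV.mem_nhds hxb)).tendsto
    obtain ⟨δ, hδ, h⟩ := Metric.eventually_nhds_iff_ball.mp
      ((Metric.tendsto_nhds.mp hcont (ε / 4) (by positivity)).and (hV.mem_nhds hxb))
    refine ⟨Metric.ball x δ, mem_nhdsWithin_of_mem_nhds (Metric.ball_mem_nhds x hδ), ?_⟩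
    filter_upwards [mem_nhdsWithin_of_mem_nhds (Metric.ball_mem_nhds b hδ), self_mem_nhdsWithin]
      with y hy hyb s hs
    have hmem : ∀ t ∈ Metric.ball b δ, (s, t) ∈ Metric.ball (x, b) δ := fun t ht ↦ by
      simpa [← ball_prod_same] using ⟨hs, ht⟩
    set c := pderivSnd Φ (s, b)
    have hbound : ∀ t ∈ Metric.ball b δ, ‖pderivSnd Φ (s, t) - c‖ ≤ ε / 2 := by
      intro t ht
      have h1 := (h _ (hmem t ht)).1
      have h2 := (h _ (hmem b (Metric.mem_ball_self hδ))).1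
      rw [dist_comm] at h2
      rw [← dist_eq_norm]
      calc dist (pderivSnd Φ (s, t)) c ≤ _ := dist_triangle _ (pderivSnd Φ (x, b)) _
        _ ≤ ε / 2 := by linarith
    -- Subtracting the linear term t·c makes the derivative small, so the mean value inequality
    -- bounds the slope's distance from c.
    have hder : ∀ t ∈ Metric.ball b δ, HasDerivWithinAt (fun t ↦ Φ (s, t) - t * c)
        (pderivSnd Φ (s, t) - c) (Metric.ball b δ) t := by
      intro t ht
      have h1 := (differentiableAt_snd hV hd (h _ (hmem t ht)).2).hasDerivAt
      simpa using! (h1.sub ((hasDerivAt_id t).mul_const c)).hasDerivWithinAt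
    have hmv := (convex_ball b δ).norm_image_sub_le_of_norm_hasDerivWithin_le hder hbound
      (Metric.mem_ball_self hδ) hy
    have hne : y - b ≠ 0 := sub_ne_zero.mpr hyb
    have heq : c - slope (fun t ↦ Φ (s, t)) b y =
        -((y - b)⁻¹ * (Φ (s, y) - y * c - (Φ (s, b) - b * c))) := by
      rw [slope_def_field]
      field_simp
      ring
    rw [dist_eq_norm, heq, norm_neg, norm_mul, norm_inv]
    have hpos : 0 < ‖y - b‖ := norm_pos_iff.mpr hne
    calc ‖y - b‖⁻¹ * _ ≤ ‖y - b‖⁻¹ * (ε / 2 * ‖y - b‖) := by gcongr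
      _ = ε / 2 := by field_simp
      _ < ε := half_lt_self hε
  have hF : ∀ y ∈ Metric.ball b r,
      ∀ s ∈ Metric.ball a r, DifferentiableAt ℂ (fun s ↦ Φ (s, y)) s :=
    fun y hy s hs ↦ differentiableAt_fst hV hd (hball s hs y hy)
  have hb := Metric.mem_ball_self (x := b) hr
  have ha := Metric.mem_ball_self (x := a) hr
  have hbr : Metric.ball b r ∈ 𝓝[≠] b := mem_nhdsWithin_of_mem_nhds (Metric.ball_mem_nhds b hr)
  have hderiv := (hlim.deriv (by
    filter_upwards [hbr] with y hy s hs
    simp only [slope_def_field]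
    exact (((hF y hy s hs).sub (hF b hb s hs)).div_const _).differentiableWithinAt)
    Metric.isOpen_ball).tendsto_at ha
  rw [hasDerivAt_iff_tendsto_slope]
  refine hderiv.congr' ?_
  filter_upwards [hbr] with y hy
  simp only [Function.comp_apply, slope_def_field]
  rw [deriv_div_const, deriv_fun_sub (hF y hy a ha) (hF b hb a ha)]
  rfl

theorem hasDerivAt_pderivSnd_fst (hV : IsOpen V) (hd : DifferentiableOn ℂ Φ V) {v : ℂ × ℂ}
    (hv : v ∈ V) :
    HasDerivAt (fun y ↦ pderivSnd Φ (y, v.2)) (pderivSnd (pderivFst Φ) v) v.1 :=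
  hasDerivAt_pderivFst_snd (Φ := Φ ∘ Prod.swap) (isOpen_swap hV) (v := v.swap)
    (hd.comp differentiable_swap.differentiableOn fun _ h ↦ h) hv

theorem pderivSnd_pderivFst (hV : IsOpen V) (hd : DifferentiableOn ℂ Φ V) {v : ℂ × ℂ}
    (hv : v ∈ V) : pderivSnd (pderivFst Φ) v = pderivFst (pderivSnd Φ) v :=
  (hasDerivAt_pderivFst_snd hV hd hv).deriv

/-- Both partial derivatives of `pderivFst Φ` exist and are continuous, which gives Fréchet
differentiability. -/
theorem differentiableOn_pderivFst (hV : IsOpen V) (hd : DifferentiableOn ℂ Φ V) :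
    DifferentiableOn ℂ (pderivFst Φ) V := by
  have hc1 := continuousOn_pderivFst hV hd.continuousOn fun v ↦ differentiableAt_fst hV hd
  have hc2 := continuousOn_pderivSnd hV hd.continuousOn fun v ↦ differentiableAt_snd hV hd
  have hd11 : ∀ v ∈ V, DifferentiableAt ℂ (fun s ↦ pderivFst Φ (s, v.2)) v.1 := by
    rintro ⟨a, b⟩ hv
    obtain ⟨r, hr, hball⟩ := exists_ball_prod_subset hV hv
    have : DifferentiableOn ℂ (fun s ↦ Φ (s, b)) (Metric.ball a r) := fun s hs ↦
      (differentiableAt_fst hV hd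
        (hball s hs b (Metric.mem_ball_self hr))).differentiableWithinAt
    exact (this.deriv Metric.isOpen_ball).differentiableAt (Metric.ball_mem_nhds a hr)
  have hc11 := continuousOn_pderivFst hV hc1 hd11
  have hc12 := continuousOn_pderivFst hV hc2
    fun v hv ↦ (hasDerivAt_pderivSnd_fst hV hd hv).differentiableAt
  intro u hu
  have hc11' := hc11.continuousAt (hV.mem_nhds hu)
  have hc12' := hc12.continuousAt (hV.mem_nhds hu)
  refine (hasStrictFDerivAt_uncurry_coprod (𝕜 := ℂ) (u := u)
    (f := fun s t ↦ pderivFst Φ (s, t))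
    (f₁ := fun s t ↦ ContinuousLinearMap.toSpanSingleton ℂ (pderivFst (pderivFst Φ) (s, t)))
    (f₂ := fun s t ↦ ContinuousLinearMap.toSpanSingleton ℂ (pderivFst (pderivSnd Φ) (s, t)))
    ?_ ?_ ?_ ?_).hasFDerivAt.differentiableAt.differentiableWithinAt
  · filter_upwards [hV.mem_nhds hu] with v hv
    exact (hd11 v hv).hasDerivAt.hasFDerivAt
  · filter_upwards [hV.mem_nhds hu] with v hv
    exact (hasDerivAt_pderivFst_snd hV hd hv).hasFDerivAt
  · exact (ContinuousLinearMap.toSpanSingletonCLE (𝕜 := ℂ)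
      (E := ℂ)).continuous.continuousAt.comp hc11'
  · exact (ContinuousLinearMap.toSpanSingletonCLE (𝕜 := ℂ)
      (E := ℂ)).continuous.continuousAt.comp hc12'

theorem differentiableOn_pderivSnd (hV : IsOpen V) (hd : DifferentiableOn ℂ Φ V) :
    DifferentiableOn ℂ (pderivSnd Φ) V := by
  have h := differentiableOn_pderivFst (Φ := Φ ∘ Prod.swap) (isOpen_swap hV)
    (hd.comp differentiable_swap.differentiableOn fun _ h ↦ h)
  exact h.comp (t := Prod.swap ⁻¹' V) (f := Prod.swap) differentiable_swap.differentiableOn fun v hv ↦ by simpa using hv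

/-- The chain rule along a curve in `ℂ²`, in terms of partial derivatives. -/
theorem hasDerivAt_comp_prodMk (hV : IsOpen V) (hd : DifferentiableOn ℂ Φ V) {f g : ℂ → ℂ}
    {f' g' z : ℂ} (hf : HasDerivAt f f' z) (hg : HasDerivAt g g' z) (hz : (f z, g z) ∈ V) :
    HasDerivAt (fun w ↦ Φ (f w, g w))
      (f' * pderivFst Φ (f z, g z) + g' * pderivSnd Φ (f z, g z)) z := by
  have hΦ := (hd.differentiableAt (hV.mem_nhds hz)).hasFDerivAt
  have h1 : HasDerivAt (fun s ↦ Φ (s, g z)) _ (f z) := hΦ.comp_hasDerivAt (f z)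
    ((hasDerivAt_id (f z)).prodMk (hasDerivAt_const (f z) (g z)))
  have h2 : HasDerivAt (fun s ↦ Φ (f z, s)) _ (g z) := hΦ.comp_hasDerivAt (g z)
    ((hasDerivAt_const (g z) (f z)).prodMk (hasDerivAt_id (g z)))
  have h := hΦ.comp_hasDerivAt z (hf.prodMk hg)
  convert! h using 1
  rw [pderivFst, pderivSnd, h1.deriv, h2.deriv, ← smul_eq_mul, ← smul_eq_mul, ← map_smul,
    ← map_smul, ← map_add]
  simp

end Partial

/-! ### The hypergeometric equation of E₄^(1/4) in t = 1/j -/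

section OneVariable

open Filter Topology Set
open scoped Manifold

/-- The Eisenstein series `E₂` as a function of a complex variable. -/
noncomputable def e2 (τ : ℂ) : ℂ := EisensteinSeries.E2 (UpperHalfPlane.ofComplex τ)

/-- The Eisenstein series `E₆` as a function of a complex variable. -/
noncomputable def e6 (τ : ℂ) : ℂ := ModularForm.E₆ (UpperHalfPlane.ofComplex τ)

/-- The function `t = 1 / j`. -/
noncomputable def tInv (τ : ℂ) : ℂ := 1 / jInv τ

/-- The logarithmic derivative `2πi E₆ / E₄` of `1 / j`. -/
noncomputable def tLog (τ : ℂ) : ℂ := 2 * Real.pi * Complex.I * (e6 τ / e4 τ)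

variable {τ : ℂ}

theorem hasDerivAt_of_normalizedDeriv {f : UpperHalfPlane → ℂ} (hf : MDiff f) (hτ : 0 < τ.im) :
    HasDerivAt (fun τ ↦ f (UpperHalfPlane.ofComplex τ)) (2 * Real.pi * Complex.I *
      Derivative.normalizedDerivOfComplex f (UpperHalfPlane.ofComplex τ)) τ := by
  have h := ((UpperHalfPlane.mdifferentiable_iff.mp hf).differentiableAt
    (UpperHalfPlane.isOpen_upperHalfPlaneSet.mem_nhds hτ)).hasDerivAt
  rw [Derivative.normalizedDerivOfComplex, mul_inv_cancel_left₀ Complex.two_pi_I_ne_zero,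
    UpperHalfPlane.ofComplex_apply_of_im_pos hτ]
  exact h

theorem hasDerivAt_e4 (hτ : 0 < τ.im) :
    HasDerivAt e4 (2 * Real.pi * Complex.I * ((e2 τ * e4 τ - e6 τ) / 3)) τ := by
  have h := hasDerivAt_of_normalizedDeriv (ModularFormClass.holo ModularForm.E₄) hτ
  rwa [normalizedDeriv_E₄] at h

theorem hasDerivAt_e6 (hτ : 0 < τ.im) :
    HasDerivAt e6 (2 * Real.pi * Complex.I * ((e2 τ * e6 τ - e4 τ ^ 2) / 2)) τ := by
  have h := hasDerivAt_of_normalizedDeriv (ModularFormClass.holo ModularForm.E₆) hτ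
  rwa [normalizedDeriv_E₆] at h

theorem hasDerivAt_e2 (hτ : 0 < τ.im) :
    HasDerivAt e2 (2 * Real.pi * Complex.I * ((e2 τ ^ 2 - e4 τ) / 12)) τ := by
  have h := hasDerivAt_of_normalizedDeriv E2_mdifferentiable hτ
  rwa [normalizedDeriv_E2] at h

theorem e4_cube_sub_e6_sq_ne_zero (τ : ℂ) : e4 τ ^ 3 - e6 τ ^ 2 ≠ 0 := by
  have h := ModularForm.discriminant_ne_zero (UpperHalfPlane.ofComplex τ)
  rw [ModularForm.discriminant_eq_E₄_cube_sub_E₆_sq] at h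
  exact fun h0 ↦ h ((congrArg (· / (1728 : ℂ)) h0).trans (zero_div _))

theorem jInv_eq (τ : ℂ) : jInv τ = e4 τ ^ 3 / ((e4 τ ^ 3 - e6 τ ^ 2) / 1728) := by
  rw [jInv, ModularForm.discriminant_eq_E₄_cube_sub_E₆_sq]
  rfl

theorem e4_ne_zero_of_jInv_ne_zero (h : jInv τ ≠ 0) : e4 τ ≠ 0 := by
  rintro h0
  simp [jInv, h0] at h

theorem jInv_ne_zero_of_e4_ne_zero (h : e4 τ ≠ 0) : jInv τ ≠ 0 := by
  rw [jInv_eq]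
  exact div_ne_zero (pow_ne_zero 3 h) (div_ne_zero (e4_cube_sub_e6_sq_ne_zero τ) (by norm_num))

theorem tInv_eq (τ : ℂ) : tInv τ = (e4 τ ^ 3 - e6 τ ^ 2) / (1728 * e4 τ ^ 3) := by
  rw [tInv, jInv_eq, one_div_div, div_div]

theorem one_sub_mul_tInv (h : e4 τ ≠ 0) : 1 - 1728 * tInv τ = e6 τ ^ 2 / e4 τ ^ 3 := by
  rw [tInv_eq]
  field_simp
  ring

theorem tInv_ne_zero (h : e4 τ ≠ 0) : tInv τ ≠ 0 := one_div_ne_zero (jInv_ne_zero_of_e4_ne_zero h)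

theorem tLog_ne_zero (h : e4 τ ≠ 0) (h6 : e6 τ ≠ 0) : tLog τ ≠ 0 :=
  mul_ne_zero Complex.two_pi_I_ne_zero (div_ne_zero h6 h)

/-- With D = q d/dq, D log(E₄³ - E₆²) = E₂ and 3 D log E₄ = E₂ - E₆/E₄; their difference is E₆/E₄.
-/
theorem hasDerivAt_tInv (hτ : 0 < τ.im) (h : e4 τ ≠ 0) :
    HasDerivAt tInv (tLog τ * tInv τ) τ := by
  have h1 := (((hasDerivAt_e4 hτ).pow 3).sub ((hasDerivAt_e6 hτ).pow 2)).div
    (((hasDerivAt_e4 hτ).pow 3).const_mul 1728)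
    (mul_ne_zero (by norm_num) (pow_ne_zero 3 h))
  refine HasDerivAt.congr_of_eventuallyEq (h1.congr_deriv ?_) (Eventually.of_forall tInv_eq)
  rw [tInv_eq, tLog]
  simp only [Pi.pow_apply, Pi.sub_apply]
  field_simp
  push_cast
  ring

/-- The logarithmic derivative of `E₄ ^ (1 / 4)`, relative to that of `1 / j`. -/
noncomputable def rootLog (τ : ℂ) : ℂ := (e2 τ * e4 τ - e6 τ) / (12 * e6 τ)

/-- The hypergeometric equation in Riccati form: if k = θg/g and K = θk, then K + k² = θ²g/g. No
branch of E₄^(1/4) is needed. -/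
theorem hasDerivAt_rootLog (hτ : 0 < τ.im) (h : e4 τ ≠ 0) (h6 : e6 τ ≠ 0) :
    ∃ K, HasDerivAt rootLog (tLog τ * K) τ ∧
      (1 - 1728 * tInv τ) * (K + rootLog τ ^ 2) = 864 * tInv τ * rootLog τ + 60 * tInv τ := by
  have h1 := (((hasDerivAt_e2 hτ).mul (hasDerivAt_e4 hτ)).sub (hasDerivAt_e6 hτ)).div
    ((hasDerivAt_e6 hτ).const_mul 12) (mul_ne_zero (by norm_num) h6)
  refine ⟨_, HasDerivAt.congr_deriv h1 (mul_div_cancel₀ _ (tLog_ne_zero h h6)).symm, ?_⟩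
  have hI := Complex.two_pi_I_ne_zero
  rw [one_sub_mul_tInv h, tInv_eq, tLog, rootLog]
  simp only [Pi.mul_apply, Pi.sub_apply]
  generalize (2 * Real.pi * Complex.I : ℂ) = c at *
  field_simp
  ring

end OneVariable

/-! ### From ordinary equations along curves to the partial differential system -/

section ODE

open Filter Topology

variable {V : Set (ℂ × ℂ)} {Φ : ℂ × ℂ → ℂ}

theorem Dx_eq (Φ : ℂ × ℂ → ℂ) (v : ℂ × ℂ) : Dx Φ v = v.1 * pderivFst Φ v := rfl

theorem Dy_eq (Φ : ℂ × ℂ → ℂ) (v : ℂ × ℂ) : Dy Φ v = v.2 * pderivSnd Φ v := rfl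

theorem differentiableOn_Dx (hV : IsOpen V) (hd : DifferentiableOn ℂ Φ V) :
    DifferentiableOn ℂ (Dx Φ) V :=
  differentiable_fst.differentiableOn.mul (differentiableOn_pderivFst hV hd)

theorem differentiableOn_Dy (hV : IsOpen V) (hd : DifferentiableOn ℂ Φ V) :
    DifferentiableOn ℂ (Dy Φ) V :=
  differentiable_snd.differentiableOn.mul (differentiableOn_pderivSnd hV hd)

theorem Dy_Dx (hV : IsOpen V) (hd : DifferentiableOn ℂ Φ V) {v : ℂ × ℂ} (hv : v ∈ V) :
    Dy (Dx Φ) v = Dx (Dy Φ) v := by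
  have h1 : Dy (Dx Φ) v = v.2 * (v.1 * pderivSnd (pderivFst Φ) v) := by
    rw [Dy]
    congr 1
    exact deriv_const_mul_field _
  have h2 : Dx (Dy Φ) v = v.1 * (v.2 * pderivFst (pderivSnd Φ) v) := by
    rw [Dx]
    congr 1
    exact deriv_const_mul_field _
  rw [h1, h2, pderivSnd_pderivFst hV hd hv]
  ring

theorem hasDerivAt_comp_of_log (hV : IsOpen V) (hd : DifferentiableOn ℂ Φ V) {X Y : ℂ → ℂ}
    {l a b z : ℂ} (hX : HasDerivAt X (l * (a * X z)) z) (hY : HasDerivAt Y (l * (b * Y z)) z)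
    (hz : (X z, Y z) ∈ V) :
    HasDerivAt (fun w ↦ Φ (X w, Y w))
      (l * (a * Dx Φ (X z, Y z) + b * Dy Φ (X z, Y z))) z := by
  refine (hasDerivAt_comp_prodMk hV hd hX hY hz).congr_deriv ?_
  rw [Dx_eq, Dy_eq]
  ring

/-- The second-order equation satisfied by `Φ` along a curve `(X, Y)` on which the logarithmic
derivatives of `X`, `Y` and `Φ`, relative to a function `l`, are `a`, `1 - 2 a` and `k`. -/
theorem second_order_along_curve (hV : IsOpen V) (hd : DifferentiableOn ℂ Φ V)
    {X Y f l a k : ℂ → ℂ} {A K z : ℂ}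
    (hX : ∀ᶠ w in 𝓝 z, HasDerivAt X (l w * (a w * X w)) w)
    (hY : ∀ᶠ w in 𝓝 z, HasDerivAt Y (l w * ((1 - 2 * a w) * Y w)) w)
    (hf : ∀ᶠ w in 𝓝 z, HasDerivAt f (l w * (k w * f w)) w)
    (hΦ : ∀ᶠ w in 𝓝 z, (X w, Y w) ∈ V ∧ f w = Φ (X w, Y w))
    (hl : ∀ᶠ w in 𝓝 z, l w ≠ 0)
    (ha : HasDerivAt a (l z * A) z) (hk : HasDerivAt k (l z * K) z) :
    a z * Dx Φ (X z, Y z) + (1 - 2 * a z) * Dy Φ (X z, Y z) = k z * Φ (X z, Y z) ∧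
    a z ^ 2 * Dx (Dx Φ) (X z, Y z) + 2 * a z * (1 - 2 * a z) * Dx (Dy Φ) (X z, Y z)
      + (1 - 2 * a z) ^ 2 * Dy (Dy Φ) (X z, Y z)
      + A * (Dx Φ (X z, Y z) - 2 * Dy Φ (X z, Y z)) = (K + k z ^ 2) * Φ (X z, Y z) := by
  -- The first-order relation is needed on a neighbourhood because it is differentiated once more
  -- below.
  have hfirst : ∀ᶠ w in 𝓝 z,
      k w * f w = a w * Dx Φ (X w, Y w) + (1 - 2 * a w) * Dy Φ (X w, Y w) := by
    filter_upwards [hX, hY, hf, hΦ.eventually_nhds, hl] with w hX hY hf hΦ hl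
    have h := hasDerivAt_comp_of_log hV hd hX hY hΦ.self_of_nhds.1
    have h' := h.congr_of_eventuallyEq (hΦ.mono fun _ h ↦ h.2)
    exact mul_left_cancel₀ hl (hf.unique h')
  have hzV := hΦ.self_of_nhds
  have hlz := hl.self_of_nhds
  have hP := hasDerivAt_comp_of_log hV (differentiableOn_Dx hV hd) hX.self_of_nhds
    hY.self_of_nhds hzV.1
  have hQ := hasDerivAt_comp_of_log hV (differentiableOn_Dy hV hd) hX.self_of_nhds
    hY.self_of_nhds hzV.1
  have hL := hk.mul hf.self_of_nhds
  have hR := (ha.mul hP).add (((ha.const_mul 2).const_sub 1).mul hQ)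
  have h := hL.unique (hR.congr_of_eventuallyEq hfirst)
  have h0 := hfirst.self_of_nhds
  rw [Dy_Dx hV hd hzV.1] at h
  rw [hzV.2] at h h0
  refine ⟨h0.symm, mul_left_cancel₀ hlz ?_⟩
  linear_combination -h

/-- Here vᵢ² = 1 - 1728tᵢ, v₁v₂ = S and N = 1 - S. One finds 1 - 2a = (v - w)/(vN), so in both
ordinary equations C has the same coefficient (v₁ - v₂)²/N² = 1 - 4y, and subtraction removes C. -/
theorem system_of_ordinary {v1 v2 N x y A B C P Q f : ℂ} (h1 : v1 ≠ 0) (h2 : v2 ≠ 0)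
    (h12 : v1 ^ 2 ≠ v2 ^ 2) (hN : N ≠ 0) (hv : v1 * v2 = 1 - N) (hx : x = N / 864)
    (hy : y = (1 - v1 ^ 2) * (1 - v2 ^ 2) / (4 * N ^ 2))
    (hode : ∀ v w a : ℂ, (v = v1 ∧ w = v2) ∨ (v = v2 ∧ w = v1) →
      a = w * (1 - v ^ 2) / (2 * v * N) →
      v ^ 2 * (a ^ 2 * A + 2 * a * (1 - 2 * a) * B + (1 - 2 * a) ^ 2 * C +
        a * (1 + (1 - v ^ 2) / (2 * v ^ 2) - a) * (P - 2 * Q)) =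
      (1 - v ^ 2) / 2 * (a * P + (1 - 2 * a) * Q) + 5 / 144 * (1 - v ^ 2) * f) :
    (1 - 432 * x) * A - 2 * B - 432 * x * P - 60 * x * f = 0 ∧
    (1 - 4 * y) * C + 4 * y * B - y * A + y * P - 2 * y * Q = 0 := by
  have e1 := hode v1 v2 _ (Or.inl ⟨rfl, rfl⟩) rfl
  have e2 := hode v2 v1 _ (Or.inr ⟨rfl, rfl⟩) rfl
  have hD : v2 ^ 2 - v1 ^ 2 ≠ 0 := sub_ne_zero.mpr h12.symm
  have hN1 : 1 - N ≠ 0 := hv ▸ mul_ne_zero h1 h2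
  have hv2 : v2 = (1 - N) / v1 := by
    rw [← hv]
    field_simp
  have hEq1 : (1 - 432 * x) * A - 2 * B - 432 * x * P - 60 * x * f = 0 := by
    -- The difference of the two relations is (v₂² - v₁²)/(2N) times the first equation; this is
    -- where t₁ ≠ t₂ enters.
    refine mul_left_cancel₀ (div_ne_zero hD (mul_ne_zero two_ne_zero hN)) ?_
    clear hode hD h12 h2 hv
    subst hx hv2
    linear_combination (norm := skip) e1 - e2
    clear e1 e2
    field_simp
    ring
  refine ⟨hEq1, ?_⟩
  clear hode hD h12 h2 hv e2
  subst hx hy hv2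
  -- The multiplier is the one that cancels the term in f.
  linear_combination (norm := skip) e1 - (1 - v1 ^ 2) / (2 * N) * hEq1
  clear e1 hEq1
  field_simp
  ring

end ODE

/-! ### Logarithmic derivatives of x, y and F in τ₁ -/

section Branch

open Filter Topology Set
open scoped Manifold

/-- The hypotheses under which `S` is an admissible branch of the square root on `U`. -/
structure IsBranch (U : Set (ℂ × ℂ)) (S : ℂ × ℂ → ℂ) : Prop where
  isOpen : IsOpen U
  im_pos : ∀ p ∈ U, 0 < p.1.im ∧ 0 < p.2.im
  jInv_ne_zero : ∀ p ∈ U, jInv p.1 ≠ 0 ∧ jInv p.2 ≠ 0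
  differentiableOn : DifferentiableOn ℂ S U
  sq_eq : ∀ p ∈ U, S p ^ 2 = (1 - 1728 / jInv p.1) * (1 - 1728 / jInv p.2)
  one_add_ne_zero : ∀ p ∈ U, 1 + S p ≠ 0
  xFun_ne_zero : ∀ p ∈ U, xFun S p ≠ 0

variable {U : Set (ℂ × ℂ)} {S : ℂ × ℂ → ℂ} {p : ℂ × ℂ}

theorem xFun_swap (S : ℂ × ℂ → ℂ) (p : ℂ × ℂ) : xFun (S ∘ Prod.swap) p = xFun S p.swap := by
  simp only [xFun, Function.comp_apply, Prod.fst_swap, Prod.snd_swap]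
  rw [add_comm (1 / jInv p.1), mul_comm (jInv p.1)]

theorem yFun_swap (S : ℂ × ℂ → ℂ) (p : ℂ × ℂ) : yFun (S ∘ Prod.swap) p = yFun S p.swap := by
  simp only [yFun, xFun_swap, Prod.fst_swap, Prod.snd_swap]
  rw [mul_comm (jInv p.1)]

theorem xyMap_swap (S : ℂ × ℂ → ℂ) (p : ℂ × ℂ) : xyMap (S ∘ Prod.swap) p = xyMap S p.swap := by
  rw [xyMap, xyMap, xFun_swap, yFun_swap]

theorem yFun_eq (S : ℂ × ℂ → ℂ) (p : ℂ × ℂ) :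
    yFun S p = tInv p.1 * tInv p.2 / xFun S p ^ 2 := by
  rw [yFun, tInv, tInv, div_mul_div_comm, one_mul, div_div]

namespace IsBranch

/-- The setting is symmetric in τ₁ and τ₂, so results are proved in the first variable and
transferred. -/
theorem swap (h : IsBranch U S) : IsBranch (Prod.swap ⁻¹' U) (S ∘ Prod.swap) where
  isOpen := isOpen_swap h.isOpen
  im_pos p hp := (h.im_pos _ hp).symm
  jInv_ne_zero p hp := (h.jInv_ne_zero _ hp).symm
  differentiableOn := h.differentiableOn.comp differentiable_swap.differentiableOn fun _ h ↦ h
  sq_eq p hp := (h.sq_eq _ hp).trans (mul_comm _ _)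
  one_add_ne_zero p hp := h.one_add_ne_zero _ hp
  xFun_ne_zero p hp := by
    rw [xFun_swap]
    exact h.xFun_ne_zero _ hp

theorem e4_fst_ne_zero (h : IsBranch U S) (hp : p ∈ U) : e4 p.1 ≠ 0 :=
  e4_ne_zero_of_jInv_ne_zero (h.jInv_ne_zero p hp).1

theorem e4_snd_ne_zero (h : IsBranch U S) (hp : p ∈ U) : e4 p.2 ≠ 0 :=
  e4_ne_zero_of_jInv_ne_zero (h.jInv_ne_zero p hp).2

theorem sq_eq' (h : IsBranch U S) (hp : p ∈ U) :
    S p ^ 2 = (1 - 1728 * tInv p.1) * (1 - 1728 * tInv p.2) := by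
  rw [h.sq_eq p hp, tInv, tInv, mul_one_div, mul_one_div]

/-- The numerator of x/2 is (1 - S²)/1728, and 1 + S cancels. -/
theorem xFun_eq (h : IsBranch U S) (hp : p ∈ U) : xFun S p = (1 - S p) / 864 := by
  have h1 := h.one_add_ne_zero p hp
  have h2 := h.sq_eq' hp
  have h3 : xFun S p = 2 * ((tInv p.1 + tInv p.2 - 1728 * (tInv p.1 * tInv p.2)) / (1 + S p)) := by
    rw [xFun, tInv, tInv, div_mul_div_comm, one_mul, mul_one_div]
  rw [h3]
  field_simp
  linear_combination h2

theorem hasDerivAt_fst (h : IsBranch U S) (hp : p ∈ U) :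
    HasDerivAt (fun w ↦ S (w, p.2)) (pderivFst S p) p.1 :=
  (differentiableAt_fst h.isOpen h.differentiableOn hp).hasDerivAt

theorem eventually_mem_fst (hU : IsOpen U) (hp : p ∈ U) : ∀ᶠ w in 𝓝 p.1, (w, p.2) ∈ U :=
  (hU.preimage (by fun_prop : Continuous fun w : ℂ ↦ (w, p.2))).mem_nhds hp

theorem two_mul_pderivFst (h : IsBranch U S) (hp : p ∈ U) :
    2 * S p * pderivFst S p = -(1728 * (tLog p.1 * tInv p.1)) * (1 - 1728 * tInv p.2) := by
  have h1 := (h.hasDerivAt_fst hp).pow 2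
  have h2 := (((hasDerivAt_tInv (h.im_pos p hp).1 (h.e4_fst_ne_zero hp)).const_mul
    1728).const_sub 1).mul_const (1 - 1728 * tInv p.2)
  have h3 := h1.unique (h2.congr_of_eventuallyEq
    ((eventually_mem_fst h.isOpen hp).mono fun _ hw ↦ h.sq_eq' hw))
  simpa using h3

theorem hasDerivAt_xFun_fst (h : IsBranch U S) (hp : p ∈ U) :
    HasDerivAt (fun w ↦ xFun S (w, p.2)) (-pderivFst S p / 864) p.1 :=
  (((h.hasDerivAt_fst hp).const_sub 1).div_const 864).congr_of_eventuallyEq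
    ((eventually_mem_fst h.isOpen hp).mono fun _ hw ↦ h.xFun_eq hw)

theorem hasDerivAt_yFun_fst (h : IsBranch U S) (hp : p ∈ U) :
    HasDerivAt (fun w ↦ yFun S (w, p.2))
      (yFun S p * (tLog p.1 + pderivFst S p / (432 * xFun S p))) p.1 := by
  have hx := h.xFun_ne_zero p hp
  have h1 := ((hasDerivAt_tInv (h.im_pos p hp).1 (h.e4_fst_ne_zero hp)).mul_const
    (tInv p.2)).div ((h.hasDerivAt_xFun_fst hp).pow 2) (pow_ne_zero 2 hx)
  have hfun : (fun w ↦ yFun S (w, p.2)) =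
      fun w ↦ tInv w * tInv p.2 / xFun S (w, p.2) ^ 2 := funext fun w ↦ yFun_eq S (w, p.2)
  rw [hfun, yFun_eq]
  refine HasDerivAt.congr_deriv h1 ?_
  simp only [Pi.pow_apply]
  generalize pderivFst S p = s'
  generalize xFun S p = X at *
  field_simp
  push_cast
  ring

end IsBranch

/-- The logarithmic derivative of `x`, relative to that of `1 / j(τ₁)`. -/
noncomputable def xLog (S : ℂ × ℂ → ℂ) (p : ℂ × ℂ) : ℂ :=
  S p * tInv p.1 / ((1 - 1728 * tInv p.1) * xFun S p)

namespace IsBranch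

variable (h : IsBranch U S) (hp : p ∈ U) (h1 : e6 p.1 ≠ 0) (h2 : e6 p.2 ≠ 0)
include h hp h1

theorem one_sub_fst_ne_zero : 1 - 1728 * tInv p.1 ≠ 0 := by
  rw [one_sub_mul_tInv (h.e4_fst_ne_zero hp)]
  exact div_ne_zero (pow_ne_zero 2 h1) (pow_ne_zero 3 (h.e4_fst_ne_zero hp))

include h2

theorem apply_ne_zero : S p ≠ 0 := by
  have hs := h.sq_eq' hp
  have h3 : 1 - 1728 * tInv p.2 ≠ 0 := h.swap.one_sub_fst_ne_zero (p := p.swap) hp h2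
  intro h0
  rw [h0] at hs
  exact mul_ne_zero (h.one_sub_fst_ne_zero hp h1) h3 (by rw [← hs]; ring)

theorem pderivFst_eq :
    pderivFst S p = -(864 * (tLog p.1 * tInv p.1)) * S p / (1 - 1728 * tInv p.1) := by
  have hS := h.apply_ne_zero hp h1 h2
  have hu := h.one_sub_fst_ne_zero hp h1
  have h3 := h.two_mul_pderivFst hp
  have h4 := h.sq_eq' hp
  rw [eq_div_iff hu]
  refine mul_left_cancel₀ (mul_ne_zero two_ne_zero hS) ?_
  linear_combination (1 - 1728 * tInv p.1) * h3 + 1728 * tLog p.1 * tInv p.1 * h4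

theorem hasDerivAt_xFun_log :
    HasDerivAt (fun w ↦ xFun S (w, p.2)) (tLog p.1 * (xLog S p * xFun S p)) p.1 := by
  refine (h.hasDerivAt_xFun_fst hp).congr_deriv ?_
  have hu := h.one_sub_fst_ne_zero hp h1
  have hx := h.xFun_ne_zero p hp
  rw [h.pderivFst_eq hp h1 h2, xLog]
  field_simp

theorem hasDerivAt_yFun_log :
    HasDerivAt (fun w ↦ yFun S (w, p.2)) (tLog p.1 * ((1 - 2 * xLog S p) * yFun S p)) p.1 := by
  refine (h.hasDerivAt_yFun_fst hp).congr_deriv ?_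
  have hu := h.one_sub_fst_ne_zero hp h1
  have hx := h.xFun_ne_zero p hp
  rw [h.pderivFst_eq hp h1 h2, xLog]
  field_simp
  ring

/-- Logarithmic differentiation of St₁/((1 - 1728t₁)x): S contributes -864t₁/(1 - 1728t₁), the
factor 1 - 1728t₁ twice the opposite, t₁ gives 1 and x gives -a. -/
theorem hasDerivAt_xLog :
    HasDerivAt (fun w ↦ xLog S (w, p.2)) (tLog p.1 * (xLog S p *
      (1 + 864 * tInv p.1 / (1 - 1728 * tInv p.1) - xLog S p))) p.1 := by
  have hu := h.one_sub_fst_ne_zero hp h1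
  have hx := h.xFun_ne_zero p hp
  have ht := hasDerivAt_tInv (h.im_pos p hp).1 (h.e4_fst_ne_zero hp)
  have h3 := ((h.hasDerivAt_fst hp).mul ht).div
    (((ht.const_mul 1728).const_sub 1).mul (h.hasDerivAt_xFun_log hp h1 h2)) (mul_ne_zero hu hx)
  refine h3.congr_deriv ?_
  simp only [Pi.mul_apply]
  rw [h.pderivFst_eq hp h1 h2, xLog]
  clear h3 ht
  generalize xFun S p = X at *
  obtain ⟨u, hu'⟩ : ∃ u, u = 1 - 1728 * tInv p.1 := ⟨_, rfl⟩
  have ht : tInv p.1 = (1 - u) / 1728 := by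
    rw [hu']
    ring
  rw [← hu', ht]
  rw [← hu'] at hu
  field_simp
  ring

omit h2 in
theorem hasDerivAt_root {F : ℂ × ℂ → ℂ} (hF : DifferentiableOn ℂ F U)
    (hF_pow : ∀ p ∈ U, F p ^ 4 = e4 p.1 * e4 p.2) :
    HasDerivAt (fun w ↦ F (w, p.2)) (tLog p.1 * (rootLog p.1 * F p)) p.1 := by
  have hd := (differentiableAt_fst h.isOpen hF hp).hasDerivAt
  have h4 := h.e4_fst_ne_zero hp
  have h5 := h.e4_snd_ne_zero hp
  have e := (hd.pow 4).unique
    (((hasDerivAt_e4 (h.im_pos p hp).1).mul_const (e4 p.2)).congr_of_eventuallyEq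
      ((eventually_mem_fst h.isOpen hp).mono fun _ hw ↦ hF_pow _ hw))
  have hF0 : F p ≠ 0 := fun h0 ↦ mul_ne_zero h4 h5 (by rw [← hF_pow p hp, h0]; ring)
  refine hd.congr_deriv (mul_left_cancel₀ (mul_ne_zero (by norm_num : (4 : ℂ) ≠ 0) (pow_ne_zero 3 hF0)) ?_)
  have e' : 4 * F p ^ 3 * deriv (fun s ↦ F (s, p.2)) p.1 =
    2 * Real.pi * Complex.I * ((e2 p.1 * e4 p.1 - e6 p.1) / 3) * e4 p.2 := by simpa using e
  rw [e', tLog, rootLog]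
  field_simp
  linear_combination (-(e2 p.1 * e4 p.1 - e6 p.1) * 12) * hF_pow p hp

end IsBranch

end Branch

/-! ### The two equations at generic points, then everywhere by continuity -/

section Equations

open Filter Topology Set
open scoped Manifold

variable {U W V : Set (ℂ × ℂ)} {S F Φ : ℂ × ℂ → ℂ} {z : ℂ × ℂ}

/-- The data of a holomorphic function `Φ` of `(x, y)` which represents `F` on `W`. -/
structure Represents (U : Set (ℂ × ℂ)) (S F : ℂ × ℂ → ℂ) (W V : Set (ℂ × ℂ))
    (Φ : ℂ × ℂ → ℂ) : Prop where
  branch : IsBranch U S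
  differentiableOn_root : DifferentiableOn ℂ F U
  pow_eq : ∀ p ∈ U, F p ^ 4 = e4 p.1 * e4 p.2
  isOpen_source : IsOpen W
  subset : W ⊆ U
  isOpen_target : IsOpen V
  differentiableOn : DifferentiableOn ℂ Φ V
  mem_and_eq : ∀ z ∈ W, xyMap S z ∈ V ∧ F z = Φ (xyMap S z)

namespace Represents

theorem swap (h : Represents U S F W V Φ) :
    Represents (Prod.swap ⁻¹' U) (S ∘ Prod.swap) (F ∘ Prod.swap) (Prod.swap ⁻¹' W) V Φ where
  branch := h.branch.swap
  differentiableOn_root :=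
    h.differentiableOn_root.comp differentiable_swap.differentiableOn fun _ h ↦ h
  pow_eq p hp := (h.pow_eq _ hp).trans (mul_comm _ _)
  isOpen_source := isOpen_swap h.isOpen_source
  subset _ hp := h.subset hp
  isOpen_target := h.isOpen_target
  differentiableOn := h.differentiableOn
  mem_and_eq z hz := by
    rw [xyMap_swap]
    exact h.mem_and_eq _ hz

theorem ordinary_equation_fst (h : Represents U S F W V Φ) (hz : z ∈ W) (h1 : e6 z.1 ≠ 0)
    (h2 : e6 z.2 ≠ 0) :
    (1 - 1728 * tInv z.1) * (xLog S z ^ 2 * Dx (Dx Φ) (xyMap S z) +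
      2 * xLog S z * (1 - 2 * xLog S z) * Dx (Dy Φ) (xyMap S z) +
      (1 - 2 * xLog S z) ^ 2 * Dy (Dy Φ) (xyMap S z) +
      xLog S z * (1 + 864 * tInv z.1 / (1 - 1728 * tInv z.1) - xLog S z) *
        (Dx Φ (xyMap S z) - 2 * Dy Φ (xyMap S z))) =
    864 * tInv z.1 * (xLog S z * Dx Φ (xyMap S z) + (1 - 2 * xLog S z) * Dy Φ (xyMap S z)) +
      60 * tInv z.1 * Φ (xyMap S z) := by
  have hzU := h.subset hz
  have him := (h.branch.im_pos z hzU).1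
  have hev : ∀ᶠ w in 𝓝 z.1, (w, z.2) ∈ W ∧ e6 w ≠ 0 :=
    (IsBranch.eventually_mem_fst h.isOpen_source hz).and
      ((hasDerivAt_e6 him).continuousAt.eventually_ne h1)
  obtain ⟨K, hK, hKeq⟩ := hasDerivAt_rootLog him (h.branch.e4_fst_ne_zero hzU) h1
  have hX : ∀ᶠ w in 𝓝 z.1, HasDerivAt (fun w ↦ xFun S (w, z.2))
      (tLog w * (xLog S (w, z.2) * xFun S (w, z.2))) w :=
    hev.mono fun w hw ↦ h.branch.hasDerivAt_xFun_log (p := (w, z.2)) (h.subset hw.1) hw.2 h2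
  have hY : ∀ᶠ w in 𝓝 z.1, HasDerivAt (fun w ↦ yFun S (w, z.2))
      (tLog w * ((1 - 2 * xLog S (w, z.2)) * yFun S (w, z.2))) w :=
    hev.mono fun w hw ↦ h.branch.hasDerivAt_yFun_log (p := (w, z.2)) (h.subset hw.1) hw.2 h2
  have hf : ∀ᶠ w in 𝓝 z.1, HasDerivAt (fun w ↦ F (w, z.2))
      (tLog w * (rootLog w * F (w, z.2))) w :=
    hev.mono fun w hw ↦ h.branch.hasDerivAt_root (p := (w, z.2)) (h.subset hw.1) hw.2
      h.differentiableOn_root h.pow_eq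
  have hΦ : ∀ᶠ w in 𝓝 z.1, (xFun S (w, z.2), yFun S (w, z.2)) ∈ V ∧
      F (w, z.2) = Φ (xFun S (w, z.2), yFun S (w, z.2)) :=
    hev.mono fun w hw ↦ h.mem_and_eq (w, z.2) hw.1
  have hl : ∀ᶠ w in 𝓝 z.1, tLog w ≠ 0 :=
    hev.mono fun w hw ↦
      tLog_ne_zero (h.branch.e4_fst_ne_zero (p := (w, z.2)) (h.subset hw.1)) hw.2
  obtain ⟨hA, hB⟩ := second_order_along_curve h.isOpen_target h.differentiableOn
    hX hY hf hΦ hl (h.branch.hasDerivAt_xLog hzU h1 h2) hK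
  have hxy : (xFun S (z.1, z.2), yFun S (z.1, z.2)) = xyMap S z := rfl
  rw [hxy] at hA hB
  rw [hB, hA]
  linear_combination Φ (xyMap S z) * hKeq

theorem equations_of_generic (h : Represents U S F W V Φ) (hz : z ∈ W) (h1 : e6 z.1 ≠ 0)
    (h2 : e6 z.2 ≠ 0) (hne : tInv z.1 ≠ tInv z.2) :
    FirstEquation Φ (xyMap S z) ∧ SecondEquation Φ (xyMap S z) := by
  have hzU := h.subset hz
  have o1 := h.ordinary_equation_fst hz h1 h2
  have o2 := h.swap.ordinary_equation_fst (z := z.swap) hz h2 h1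
  rw [xyMap_swap] at o2
  simp only [Prod.swap_swap, Prod.fst_swap] at o2
  have hx := h.branch.xFun_eq hzU
  have hx2 : xLog (S ∘ Prod.swap) z.swap =
      S z * tInv z.2 / ((1 - 1728 * tInv z.2) * xFun S z) := by
    rw [xLog, xFun_swap]
    simp
  have hu1 := h.branch.one_sub_fst_ne_zero hzU h1
  have hS := h.branch.apply_ne_zero hzU h1 h2
  have hsq := h.branch.sq_eq' hzU
  have hN : 1 - S z ≠ 0 := fun h0 ↦ h.branch.xFun_ne_zero z hzU (by rw [hx, h0, zero_div])
  -- Any square root v₁ serves; v₂ = S/v₁ is then a root of 1 - 1728t₂ compatible with the branch S.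
  obtain ⟨v1, hv1⟩ := IsAlgClosed.exists_pow_nat_eq (1 - 1728 * tInv z.1) two_pos
  have hv10 : v1 ≠ 0 := by
    rintro rfl
    exact hu1 (by rw [← hv1]; ring)
  have hv2 : (S z / v1) ^ 2 = 1 - 1728 * tInv z.2 := by
    rw [div_pow, hsq, hv1, mul_div_cancel_left₀ _ hu1]
  have hv20 : S z / v1 ≠ 0 := div_ne_zero hS hv10
  have hvv : v1 * (S z / v1) = S z := mul_div_cancel₀ _ hv10
  generalize S z / v1 = v2 at *
  have ht1 : tInv z.1 = (1 - v1 ^ 2) / 1728 := by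
    rw [hv1]
    ring
  have ht2 : tInv z.2 = (1 - v2 ^ 2) / 1728 := by
    rw [hv2]
    ring
  have hy : yFun S z = (1 - v1 ^ 2) * (1 - v2 ^ 2) / (4 * (1 - S z) ^ 2) := by
    rw [yFun_eq, hx, ht1, ht2]
    field_simp
    ring
  refine system_of_ordinary hv10 hv20 (fun h0 ↦ hne (by rw [ht1, ht2, h0])) hN
    (by rw [hvv]; ring) hx hy ?_
  rintro v w a (⟨rfl, rfl⟩ | ⟨rfl, rfl⟩) ha
  · have ha' : xLog S z = a := by
      rw [xLog, hx, ← hv1, ht1, ha, ← hvv]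
      rw [← hvv] at hN
      field_simp
      ring
    rw [ha', ← hv1, ht1] at o1
    convert! o1 using 2 <;> ring
  · rw [hx2, hx, ← hv2, ht2] at o2
    have ha' : S z * ((1 - v ^ 2) / 1728) / (v ^ 2 * ((1 - S z) / 864)) = a := by
      rw [ha, ← hvv]
      rw [← hvv] at hN
      field_simp
      ring
    rw [ha'] at o2
    convert! o2 using 2 <;> ring

end Represents

/-- At a zero of E₆ the derivative is -πi E₄², which is nonzero. -/
theorem exists_e6_ne_zero {τ : ℂ} (hτ : 0 < τ.im) (h4 : e4 τ ≠ 0) {O : Set ℂ} (hO : O ∈ 𝓝 τ) :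
    ∃ w ∈ O, e6 w ≠ 0 := by
  by_contra! hcon
  have h0 : e6 =ᶠ[𝓝 τ] fun _ ↦ 0 := eventually_of_mem hO hcon
  have h1 := (hasDerivAt_e6 hτ).unique ((hasDerivAt_const τ (0 : ℂ)).congr_of_eventuallyEq h0)
  rw [h0.self_of_nhds] at h1
  have h2 := (mul_eq_zero.mp h1).resolve_left Complex.two_pi_I_ne_zero
  exact pow_ne_zero 2 h4 (by linear_combination -2 * h2)

theorem exists_tInv_ne {τ : ℂ} (hτ : 0 < τ.im) (h4 : e4 τ ≠ 0) (h6 : e6 τ ≠ 0) (c : ℂ)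
    {O : Set ℂ} (hO : O ∈ 𝓝 τ) : ∃ w ∈ O, tInv w ≠ c := by
  by_contra! hcon
  have h0 : tInv =ᶠ[𝓝 τ] fun _ ↦ c := eventually_of_mem hO hcon
  have h1 := (hasDerivAt_tInv hτ h4).unique
    ((hasDerivAt_const τ c).congr_of_eventuallyEq h0)
  exact mul_ne_zero (tLog_ne_zero h4 h6) (tInv_ne_zero h4) h1

theorem IsBranch.frequently_generic (h : IsBranch U S) (hz : z ∈ U) :
    ∃ᶠ p in 𝓝 z, e6 p.1 ≠ 0 ∧ e6 p.2 ≠ 0 ∧ tInv p.1 ≠ tInv p.2 := by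
  rw [frequently_iff]
  intro O hO
  obtain ⟨O', hO', hO'open, hzO'⟩ := mem_nhds_iff.mp (inter_mem hO (h.isOpen.mem_nhds hz))
  obtain ⟨r, hr, hball⟩ := exists_ball_prod_subset hO'open hzO'
  have hm1 := Metric.mem_ball_self (x := z.1) hr
  have hm2 := Metric.mem_ball_self (x := z.2) hr
  obtain ⟨w1, hw1, h1⟩ := exists_e6_ne_zero (h.im_pos z hz).1 (h.e4_fst_ne_zero hz)
    (Metric.ball_mem_nhds z.1 hr)
  obtain ⟨w, hw, h2⟩ := exists_e6_ne_zero (h.im_pos z hz).2 (h.e4_snd_ne_zero hz)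
    (Metric.ball_mem_nhds z.2 hr)
  have hwU : (w1, w) ∈ U := (hO' (hball w1 hw1 w hw)).2
  have him := (h.im_pos _ hwU).2
  -- The second coordinate is moved once more, within E₆ ≠ 0, to avoid the value t(w₁).
  obtain ⟨w2, ⟨hw2, h6⟩, h3⟩ := exists_tInv_ne him (h.e4_snd_ne_zero hwU) h2 (tInv w1)
    (inter_mem (Metric.isOpen_ball.mem_nhds hw)
      ((hasDerivAt_e6 him).continuousAt.eventually_ne h2))
  exact ⟨(w1, w2), (hO' (hball w1 hw1 w2 hw2)).1, h1, h6, h3.symm⟩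

theorem IsBranch.continuousOn_xyMap (h : IsBranch U S) : ContinuousOn (xyMap S) U := by
  have hx : ContinuousOn (xFun S) U :=
    ((continuousOn_const.sub h.differentiableOn.continuousOn).div_const 864).congr
      fun p hp ↦ h.xFun_eq hp
  have ht1 : ContinuousOn (fun p : ℂ × ℂ ↦ tInv p.1) U := fun p hp ↦
    ((hasDerivAt_tInv (h.im_pos p hp).1 (h.e4_fst_ne_zero hp)).continuousAt.comp
      continuousAt_fst).continuousWithinAt
  have ht2 : ContinuousOn (fun p : ℂ × ℂ ↦ tInv p.2) U := fun p hp ↦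
    ((hasDerivAt_tInv (h.im_pos p hp).2 (h.e4_snd_ne_zero hp)).continuousAt.comp
      continuousAt_snd).continuousWithinAt
  exact hx.prodMk ((((ht1.mul ht2).div (hx.pow 2) fun p hp ↦
    pow_ne_zero 2 (h.xFun_ne_zero p hp))).congr fun p _ ↦ yFun_eq S p)

theorem Represents.equations (h : Represents U S F W V Φ) (hz : z ∈ W) :
    FirstEquation Φ (xyMap S z) ∧ SecondEquation Φ (xyMap S z) := by
  have hzU := h.subset hz
  have hV := h.isOpen_target
  have hxx := (differentiableOn_Dx hV (differentiableOn_Dx hV h.differentiableOn)).continuousOn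
  have hxy := (differentiableOn_Dx hV (differentiableOn_Dy hV h.differentiableOn)).continuousOn
  have hyy := (differentiableOn_Dy hV (differentiableOn_Dy hV h.differentiableOn)).continuousOn
  have hx := (differentiableOn_Dx hV h.differentiableOn).continuousOn
  have hy := (differentiableOn_Dy hV h.differentiableOn).continuousOn
  have hΦ := h.differentiableOn.continuousOn
  have hfreq := (h.branch.frequently_generic hzU).and_eventually (h.isOpen_source.mem_nhds hz)
  have hclosed : ∀ G : ℂ × ℂ → ℂ, ContinuousOn G V →
      (∀ p ∈ W, e6 p.1 ≠ 0 → e6 p.2 ≠ 0 → tInv p.1 ≠ tInv p.2 → G (xyMap S p) = 0) →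
      G (xyMap S z) = 0 := by
    intro G hG h0
    have hcont : Tendsto (fun p ↦ G (xyMap S p)) (𝓝 z) (𝓝 (G (xyMap S z))) :=
      (hG.continuousAt (hV.mem_nhds (h.mem_and_eq z hz).1)).tendsto.comp
        (h.branch.continuousOn_xyMap.continuousAt (h.branch.isOpen.mem_nhds hzU)).tendsto
    exact isClosed_singleton.mem_of_frequently_of_tendsto
      (hfreq.mono fun p hp ↦ h0 p hp.2 hp.1.1 hp.1.2.1 hp.1.2.2) hcont
  exact ⟨hclosed (fun v ↦ (1 - 432 * v.1) * Dx (Dx Φ) v - 2 * Dx (Dy Φ) v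
      - 432 * v.1 * Dx Φ v - 60 * v.1 * Φ v) (by fun_prop)
      fun p hp h1 h2 h3 ↦ (h.equations_of_generic hp h1 h2 h3).1,
    hclosed (fun v ↦ (1 - 4 * v.2) * Dy (Dy Φ) v + 4 * v.2 * Dx (Dy Φ) v - v.2 * Dx (Dx Φ) v
      + v.2 * Dx Φ v - 2 * v.2 * Dy Φ v) (by fun_prop)
      fun p hp h1 h2 h3 ↦ (h.equations_of_generic hp h1 h2 h3).2⟩

end Equations

/-! ### Invertibility of the Jacobian and local coordinates -/

section Coordinates

open Filter Topology Set
open scoped Manifold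

variable {U : Set (ℂ × ℂ)} {S Φ : ℂ × ℂ → ℂ} {p : ℂ × ℂ}

theorem hasStrictFDerivAt_of_differentiableOn {V : Set (ℂ × ℂ)} (hV : IsOpen V)
    (hd : DifferentiableOn ℂ Φ V) {v : ℂ × ℂ} (hv : v ∈ V) :
    HasStrictFDerivAt Φ ((ContinuousLinearMap.toSpanSingleton ℂ (pderivFst Φ v)).coprod
      (ContinuousLinearMap.toSpanSingleton ℂ (pderivSnd Φ v))) v := by
  have hc1 := (differentiableOn_pderivFst hV hd).continuousOn.continuousAt (hV.mem_nhds hv)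
  have hc2 := (differentiableOn_pderivSnd hV hd).continuousOn.continuousAt (hV.mem_nhds hv)
  refine hasStrictFDerivAt_uncurry_coprod (𝕜 := ℂ) (u := v) (f := fun s t ↦ Φ (s, t))
    (f₁ := fun s t ↦ ContinuousLinearMap.toSpanSingleton ℂ (pderivFst Φ (s, t)))
    (f₂ := fun s t ↦ ContinuousLinearMap.toSpanSingleton ℂ (pderivSnd Φ (s, t))) ?_ ?_ ?_ ?_
  · filter_upwards [hV.mem_nhds hv] with w hw
    exact (differentiableAt_fst hV hd hw).hasDerivAt.hasFDerivAt
  · filter_upwards [hV.mem_nhds hv] with w hw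
    exact (differentiableAt_snd hV hd hw).hasDerivAt.hasFDerivAt
  · exact (ContinuousLinearMap.toSpanSingletonCLE (𝕜 := ℂ)
      (E := ℂ)).continuous.continuousAt.comp hc1
  · exact (ContinuousLinearMap.toSpanSingletonCLE (𝕜 := ℂ)
      (E := ℂ)).continuous.continuousAt.comp hc2

theorem tLog_eq_zero_iff {τ : ℂ} (h4 : e4 τ ≠ 0) : tLog τ = 0 ↔ e6 τ = 0 := by
  simp [tLog, h4, Real.pi_ne_zero, Complex.I_ne_zero]

namespace IsBranch

theorem differentiableOn_xFun (h : IsBranch U S) : DifferentiableOn ℂ (xFun S) U :=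
  ((h.differentiableOn.const_sub 1).mul_const (864 : ℂ)⁻¹).congr fun _ hp ↦
    (h.xFun_eq hp).trans (div_eq_mul_inv _ _)

theorem differentiableOn_yFun (h : IsBranch U S) : DifferentiableOn ℂ (yFun S) U := by
  have ht1 : DifferentiableOn ℂ (fun p : ℂ × ℂ ↦ tInv p.1) U := fun p hp ↦
    ((hasDerivAt_tInv (h.im_pos p hp).1 (h.e4_fst_ne_zero hp)).differentiableAt.comp p
      _root_.differentiableAt_fst).differentiableWithinAt
  have ht2 : DifferentiableOn ℂ (fun p : ℂ × ℂ ↦ tInv p.2) U := fun p hp ↦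
    ((hasDerivAt_tInv (h.im_pos p hp).2 (h.e4_snd_ne_zero hp)).differentiableAt.comp p
      _root_.differentiableAt_snd).differentiableWithinAt
  exact ((ht1.mul ht2).mul ((h.differentiableOn_xFun.pow 2).inv fun p hp ↦
    pow_ne_zero 2 (h.xFun_ne_zero p hp))).congr fun p _ ↦
      (yFun_eq S p).trans (div_eq_mul_inv _ _)

theorem yFun_ne_zero (h : IsBranch U S) (hp : p ∈ U) : yFun S p ≠ 0 := by
  rw [yFun_eq]
  exact div_ne_zero (mul_ne_zero (tInv_ne_zero (h.e4_fst_ne_zero hp))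
    (tInv_ne_zero (h.e4_snd_ne_zero hp))) (pow_ne_zero 2 (h.xFun_ne_zero p hp))

theorem pderivFst_xFun (h : IsBranch U S) (hp : p ∈ U) :
    pderivFst (xFun S) p = -pderivFst S p / 864 := (h.hasDerivAt_xFun_fst hp).deriv

theorem pderivFst_yFun (h : IsBranch U S) (hp : p ∈ U) :
    pderivFst (yFun S) p = yFun S p * (tLog p.1 + pderivFst S p / (432 * xFun S p)) :=
  (h.hasDerivAt_yFun_fst hp).deriv

theorem pderivSnd_xFun (h : IsBranch U S) (hp : p ∈ U) :
    pderivSnd (xFun S) p = -pderivSnd S p / 864 := by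
  have e := h.swap.pderivFst_xFun (p := p.swap) hp
  rwa [show xFun (S ∘ Prod.swap) = xFun S ∘ Prod.swap from funext (xFun_swap S)] at e

theorem pderivSnd_yFun (h : IsBranch U S) (hp : p ∈ U) :
    pderivSnd (yFun S) p = yFun S p * (tLog p.2 + pderivSnd S p / (432 * xFun S p)) := by
  have e := h.swap.pderivFst_yFun (p := p.swap) hp
  rw [xFun_swap, yFun_swap, Prod.swap_swap] at e
  rwa [show yFun (S ∘ Prod.swap) = yFun S ∘ Prod.swap from funext (yFun_swap S)] at e

/-- At a zero of `E₆(τ₁)` the branch `S` has a simple zero in the first variable. -/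
theorem pderivFst_ne_zero (h : IsBranch U S) (hp : p ∈ U) (h1 : e6 p.1 = 0) (h2 : e6 p.2 ≠ 0) :
    pderivFst S p ≠ 0 := by
  have h4 := h.e4_fst_ne_zero hp
  have hu2 : 1 - 1728 * tInv p.2 ≠ 0 := h.swap.one_sub_fst_ne_zero (p := p.swap) hp h2
  have him := (h.im_pos p hp).1
  have hS0 : S p = 0 := by
    have := h.sq_eq' hp
    rw [one_sub_mul_tInv h4, h1] at this
    simpa using this
  -- S and E₆ both vanish at the point, so squared difference quotients can be compared through S² =
  -- E₆²E₄⁻³(1 - 1728t₂).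
  have hlim1 := (hasDerivAt_iff_tendsto_slope.mp (h.hasDerivAt_fst hp)).pow 2
  have hlim2 := ((hasDerivAt_iff_tendsto_slope.mp (hasDerivAt_e6 him)).pow 2).mul
    ((((hasDerivAt_e4 him).continuousAt.tendsto.pow 3).inv₀ (pow_ne_zero 3 h4)).mono_left
      nhdsWithin_le_nhds |>.mul_const (1 - 1728 * tInv p.2))
  have hev : ∀ᶠ w in 𝓝[≠] p.1, slope e6 p.1 w ^ 2 * ((e4 w ^ 3)⁻¹ * (1 - 1728 * tInv p.2)) =
      slope (fun w ↦ S (w, p.2)) p.1 w ^ 2 := by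
    filter_upwards [(eventually_mem_fst h.isOpen hp).filter_mono nhdsWithin_le_nhds] with w hw
    have h5 := h.e4_fst_ne_zero hw
    have h6 := h.sq_eq' hw
    simp only [slope_def_field, h1, sub_zero]
    rw [show S (p.1, p.2) = 0 from hS0, sub_zero, div_pow, div_pow, h6, one_sub_mul_tInv h5]
    ring
  have heq := tendsto_nhds_unique hlim1 (hlim2.congr' hev)
  intro h0
  rw [h0, h1] at heq
  have hI := Complex.two_pi_I_ne_zero
  refine absurd heq.symm ?_
  rw [zero_pow two_ne_zero]
  refine mul_ne_zero (pow_ne_zero 2 (mul_ne_zero hI ?_))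
    (mul_ne_zero (inv_ne_zero (pow_ne_zero 3 h4)) hu2)
  simpa using h4

/-- Let L₁, L₂ be the two parts of d log(t₁t₂) on the vector. Then L₁ + L₂ = 0, and d(S²) = 0 gives
L₁t₁(1 - 1728t₂) + L₂t₂(1 - 1728t₁) = 0, whence (t₁ - t₂)L₁ = 0. -/
theorem eq_zero_of_jacobian_apply (h : IsBranch U S) (hp : p ∈ U) (hne : tInv p.1 ≠ tInv p.2)
    {a b : ℂ} (hx : a * pderivFst (xFun S) p + b * pderivSnd (xFun S) p = 0)
    (hy : a * pderivFst (yFun S) p + b * pderivSnd (yFun S) p = 0) : a = 0 ∧ b = 0 := by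
  have h41 := h.e4_fst_ne_zero hp
  have h42 := h.e4_snd_ne_zero hp
  rw [h.pderivFst_xFun hp, h.pderivSnd_xFun hp] at hx
  rw [h.pderivFst_yFun hp, h.pderivSnd_yFun hp] at hy
  have hS : a * pderivFst S p + b * pderivSnd S p = 0 := by linear_combination -864 * hx
  have hL : a * tLog p.1 + b * tLog p.2 = 0 := by
    refine mul_left_cancel₀ (h.yFun_ne_zero hp) ?_
    linear_combination hy - yFun S p / (432 * xFun S p) * hS
  have e1 := h.two_mul_pderivFst hp
  have e2 : 2 * S p * pderivSnd S p = -(1728 * (tLog p.2 * tInv p.2)) * (1 - 1728 * tInv p.1) :=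
    h.swap.two_mul_pderivFst (p := p.swap) hp
  have hd := sub_ne_zero.mpr hne
  have hL1 : a * tLog p.1 = 0 := by
    refine (mul_eq_zero.mp (?_ : (tInv p.1 - tInv p.2) * (a * tLog p.1) = 0)).resolve_left hd
    linear_combination (1 / 1728) * (a * e1 + b * e2) - tInv p.2 * (1 - 1728 * tInv p.1) * hL
      - (1 / 864) * S p * hS
  have hL2 : b * tLog p.2 = 0 := by linear_combination hL - hL1
  by_cases h61 : e6 p.1 = 0
  -- If both E₆ values vanish, then t₁ = t₂ = 1/1728, which is excluded.
  · by_cases h62 : e6 p.2 = 0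
    · have f1 := one_sub_mul_tInv h41
      have f2 := one_sub_mul_tInv h42
      rw [h61] at f1
      rw [h62] at f2
      refine absurd ?_ hne
      linear_combination (1 / 1728 : ℂ) * (f2 - f1)
    · have hb := (mul_eq_zero.mp hL2).resolve_right (mt (tLog_eq_zero_iff h42).mp h62)
      rw [hb, zero_mul, add_zero] at hS
      exact ⟨(mul_eq_zero.mp hS).resolve_right (h.pderivFst_ne_zero hp h61 h62), hb⟩
  · have ha := (mul_eq_zero.mp hL1).resolve_right (mt (tLog_eq_zero_iff h41).mp h61)
    refine ⟨ha, ?_⟩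
    by_cases h62 : e6 p.2 = 0
    · rw [ha, zero_mul, zero_add] at hS
      exact (mul_eq_zero.mp hS).resolve_right
        (h.swap.pderivFst_ne_zero (p := p.swap) hp h62 h61)
    · exact (mul_eq_zero.mp hL2).resolve_right (mt (tLog_eq_zero_iff h42).mp h62)

theorem exists_hasStrictFDerivAt_xyMap (h : IsBranch U S) (hp : p ∈ U)
    (hne : tInv p.1 ≠ tInv p.2) :
    ∃ e : (ℂ × ℂ) ≃L[ℂ] ℂ × ℂ, HasStrictFDerivAt (xyMap S) (e : ℂ × ℂ →L[ℂ] ℂ × ℂ) p := by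
  have hx := hasStrictFDerivAt_of_differentiableOn h.isOpen h.differentiableOn_xFun hp
  have hy := hasStrictFDerivAt_of_differentiableOn h.isOpen h.differentiableOn_yFun hp
  have hxy := hx.prodMk hy
  set L := ((ContinuousLinearMap.toSpanSingleton ℂ (pderivFst (xFun S) p)).coprod
      (ContinuousLinearMap.toSpanSingleton ℂ (pderivSnd (xFun S) p))).prod
    ((ContinuousLinearMap.toSpanSingleton ℂ (pderivFst (yFun S) p)).coprod
      (ContinuousLinearMap.toSpanSingleton ℂ (pderivSnd (yFun S) p))) with hL
  have hinj : Function.Injective (L : ℂ × ℂ →ₗ[ℂ] ℂ × ℂ) := by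
    rw [← LinearMap.ker_eq_bot, LinearMap.ker_eq_bot']
    rintro ⟨a, b⟩ hab
    have hab' := Prod.ext_iff.mp hab
    obtain ⟨ha, hb⟩ := h.eq_zero_of_jacobian_apply hp hne (a := a) (b := b)
      (by simpa [hL] using hab'.1) (by simpa [hL] using hab'.2)
    rw [ha, hb, Prod.mk_zero_zero]
  refine ⟨(LinearEquiv.ofInjectiveEndo _ hinj).toContinuousLinearEquiv, ?_⟩
  convert! hxy using 1

theorem isOpen_ne (h : IsBranch U S) : IsOpen {p ∈ U | tInv p.1 ≠ tInv p.2} := by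
  rw [isOpen_iff_mem_nhds]
  rintro p ⟨hp, hne⟩
  have h1 := (hasDerivAt_tInv (h.im_pos p hp).1 (h.e4_fst_ne_zero hp)).continuousAt
  have h2 := (hasDerivAt_tInv (h.im_pos p hp).2 (h.e4_snd_ne_zero hp)).continuousAt
  exact inter_mem (h.isOpen.mem_nhds hp)
    (((ContinuousAt.sub (h1.comp continuousAt_fst) (h2.comp continuousAt_snd)).eventually_ne
      (sub_ne_zero.mpr hne)).mono fun _ h0 ↦ sub_ne_zero.mp h0)

theorem exists_openPartialHomeomorph (h : IsBranch U S) (hp : p ∈ U)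
    (hne : tInv p.1 ≠ tInv p.2) :
    ∃ e : OpenPartialHomeomorph (ℂ × ℂ) (ℂ × ℂ),
      p ∈ e.source ∧ e.source ⊆ U ∧ (∀ z ∈ e.source, e z = xyMap S z) ∧
      DifferentiableOn ℂ e.symm e.target := by
  obtain ⟨L, hL⟩ := h.exists_hasStrictFDerivAt_xyMap hp hne
  -- Restricting to t₁ ≠ t₂ makes the Jacobian invertible on the whole source, so the inverse is
  -- holomorphic on the whole target.
  let e := (hL.toOpenPartialHomeomorph (xyMap S)).restrOpen _ h.isOpen_ne
  have hsub : ∀ z ∈ e.source, z ∈ U ∧ tInv z.1 ≠ tInv z.2 := fun z hz ↦ hz.2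
  have he : ∀ z, e z = xyMap S z := fun z ↦ rfl
  refine ⟨e, ⟨hL.mem_toOpenPartialHomeomorph_source, hp, hne⟩, fun z hz ↦ (hsub z hz).1,
    fun z _ ↦ he z, fun y hy ↦ ?_⟩
  have hz := e.map_target hy
  obtain ⟨L', hL'⟩ := h.exists_hasStrictFDerivAt_xyMap (hsub _ hz).1 (hsub _ hz).2
  exact (e.hasFDerivAt_symm hy hL'.hasFDerivAt).differentiableAt.differentiableWithinAt

end IsBranch

end Coordinates

end TwoVarModular

theorem mainTheorem6
    (U : Set (ℂ × ℂ)) (hU : IsOpen U)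
    (hIm : ∀ p ∈ U, 0 < p.1.im ∧ 0 < p.2.im)
    (hj : ∀ p ∈ U, TwoVarModular.jInv p.1 ≠ 0 ∧ TwoVarModular.jInv p.2 ≠ 0)
    (S : ℂ × ℂ → ℂ) (hS : DifferentiableOn ℂ S U)
    (hS_sq : ∀ p ∈ U,
      S p ^ 2 = (1 - 1728 / TwoVarModular.jInv p.1) * (1 - 1728 / TwoVarModular.jInv p.2))
    (hS_ne : ∀ p ∈ U, 1 + S p ≠ 0)
    (hx : ∀ p ∈ U, TwoVarModular.xFun S p ≠ 0)
    (F : ℂ × ℂ → ℂ) (hF : DifferentiableOn ℂ F U)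
    (hF_pow : ∀ p ∈ U, F p ^ 4 = TwoVarModular.e4 p.1 * TwoVarModular.e4 p.2) :
    (∀ p ∈ U, TwoVarModular.jInv p.1 ≠ TwoVarModular.jInv p.2 →
      ∃ e : OpenPartialHomeomorph (ℂ × ℂ) (ℂ × ℂ),
        p ∈ e.source ∧ e.source ⊆ U ∧
        (∀ z ∈ e.source, e z = TwoVarModular.xyMap S z) ∧
        DifferentiableOn ℂ e.symm e.target) ∧
    (∀ (W V : Set (ℂ × ℂ)) (Φ : ℂ × ℂ → ℂ), IsOpen W → W ⊆ U → IsOpen V →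
      DifferentiableOn ℂ Φ V →
      (∀ z ∈ W, TwoVarModular.xyMap S z ∈ V ∧ F z = Φ (TwoVarModular.xyMap S z)) →
      ∀ z ∈ W, TwoVarModular.FirstEquation Φ (TwoVarModular.xyMap S z) ∧
        TwoVarModular.SecondEquation Φ (TwoVarModular.xyMap S z)) := by
  have hbranch : TwoVarModular.IsBranch U S := ⟨hU, hIm, hj, hS, hS_sq, hS_ne, hx⟩
  refine ⟨fun p hp hne ↦ hbranch.exists_openPartialHomeomorph hp fun h ↦ hne ?_,
    fun W V Φ hW hWU hV hΦ hrep z hz ↦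
      TwoVarModular.Represents.equations ⟨hbranch, hF, hF_pow, hW, hWU, hV, hΦ, hrep⟩ hz⟩
  simpa [TwoVarModular.tInv] using h
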